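/- Consider a finite two-player zero-sum game: player $1$ has a finite nonempty set $\mathcal{A}$ of pure strategies, player $2$ has a finite nonempty set $\mathcal{B}$ of pure strategies, and the loss functions $\ell^1,\ell^2:\mathcal{A}\times\mathcal{B}\to\mathbb{R}$ satisfy $\ell^1+\ell^2=0$. For mixed strategies $x\in\Delta(\mathcal{A})$, $y\in\Delta(\mathcal{B})$ write $\ell^i(x,y)=\mathbb{E}_{a\sim x,\,b\sim y}[\ell^i(a,b)]$. For each player $i$ let $\|\cdot\|_{(i)}$ be an arbitrary norm on $\mathbb{R}^{\mathcal{A}}$ (if $i=1$), respectively $\mathbb{R}^{\mathcal{B}}$ (if $i=2$), with dual norm $\|v\|_{(i),*}=\max_{\|u\|_{(i)}\le 1}\langle v,u\rangle$, and let $\tau^i>0$ be an arbitrary constant. In each round $t=1,2,\dots$ the players simultaneously play mixed strategies $x_t^1\in\Delta(\mathcal{A})$ and $x_t^2\in\Delta(\mathcal{B})$, and then receive as feedback the expected loss of each of their pure strategies against the opponent's mixed strategy: $$g_t^1=\big(\ell^1(a,x_t^2)\big)_{a\in\mathcal{A}},\qquad g_t^2=\big(\ell^2(x_t^1,b)\big)_{b\in\mathcal{B}},$$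 with the convention $g_0^i=0$. Both players follow optimistic multiplicative weights update (OMWU) with the adaptive learning rate, that is, for $i=1,2$, every $t\ge 1$ and every pure strategy $k$ of player $i$, $$x_{t,k}^i=\frac{\exp\!\Big(-\big(\sum_{s=1}^{t-1}g_{s,k}^i+g_{t-1,k}^i\big)/\eta_t^i\Big)}{\sum_{l}\exp\!\Big(-\big(\sum_{s=1}^{t-1}g_{s,l}^i+g_{t-1,l}^i\big)/\eta_t^i\Big)},\qquad \eta_t^i=\sqrt{\tau^i+\sum_{s=1}^{t-1}\|g_s^i-g_{s-1}^i\|_{(i),*}^2},$$ where $l$ ranges over the pure strategies of player $i$. **Theorem.** The sequence of play $(x_t^1,x_t^2)_{t\ge 1}$ converges to a Nash equilibrium: there are $x^*\in\Delta(\mathcal{A})$ and $y^*\in\Delta(\mathcal{B})$ such that $\ell^1(x^*,y^*)\le\ell^1(x',y^*)$ for all $x'\in\Delta(\mathcal{A})$, $\ell^2(x^*,y^*)\le\ell^2(x^*,y')$ for all $y'\in\Delta(\mathcal{B})$, and $x_t^1\to x^*$, $x_t^2\to y^*$ as $t\to\infty$. The Nash equilibrium of the game is not assumed to be unique. -/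

import Mathlib

open Filter Topology

noncomputable section

namespace AdaptiveOMWU

/-- The expected loss `𝔼_{a ∼ x, b ∼ y} [ℓ a b]` at the mixed profile `(x, y)`. -/
def mixedLoss {α β : Type*} [Fintype α] [Fintype β] (ℓ : α → β → ℝ)
    (x : α → ℝ) (y : β → ℝ) : ℝ :=
  ∑ a, ∑ b, x a * y b * ℓ a b

/-- `(x, y)` is a Nash equilibrium of the mixed extension of the finite two-player game with loss
functions `ℓ₁` and `ℓ₂`: both are mixed strategies, and no player can lower their own expected loss
by a unilateral deviation. -/
structure IsNash {α β : Type*} [Fintype α] [Fintype β] (ℓ₁ ℓ₂ : α → β → ℝ)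
    (x : α → ℝ) (y : β → ℝ) : Prop where
  left_mem : x ∈ stdSimplex ℝ α
  right_mem : y ∈ stdSimplex ℝ β
  left_le : ∀ x' ∈ stdSimplex ℝ α, mixedLoss ℓ₁ x y ≤ mixedLoss ℓ₁ x' y
  right_le : ∀ y' ∈ stdSimplex ℝ β, mixedLoss ℓ₂ x y ≤ mixedLoss ℓ₂ x y'

/-- The feedback of the first player: the expected loss of each pure strategy `a` against the
mixed strategy `y`. -/
def feedbackLeft {α β : Type*} [Fintype β] (ℓ₁ : α → β → ℝ) (y : β → ℝ) : α → ℝ :=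
  fun a => ∑ b, y b * ℓ₁ a b

/-- The feedback of the second player: the expected loss of each pure strategy `b` against the
mixed strategy `x`. -/
def feedbackRight {α β : Type*} [Fintype α] (ℓ₂ : α → β → ℝ) (x : α → ℝ) : β → ℝ :=
  fun b => ∑ a, x a * ℓ₂ a b

/-- The dual norm `v ↦ max {⟨v, u⟩ | N u ≤ 1}` of a norm `N` on `ℝ^ι`. -/
def dualNorm {ι : Type*} [Fintype ι] (N : Seminorm ℝ (ι → ℝ)) (v : ι → ℝ) : ℝ :=
  sSup {r : ℝ | ∃ u : ι → ℝ, N u ≤ 1 ∧ r = ∑ i, v i * u i}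

/-- The adaptive learning rate `η_t = √(τ + ∑_{s=1}^{t-1} ‖g_s - g_{s-1}‖_*²)`. -/
def adaptiveRate {ι : Type*} [Fintype ι] (N : Seminorm ℝ (ι → ℝ)) (τ : ℝ)
    (g : ℕ → ι → ℝ) (t : ℕ) : ℝ :=
  √(τ + ∑ s ∈ Finset.Ico 1 t, dualNorm N (g s - g (s - 1)) ^ 2)

/-- The exponential weight that OMWU with learning rate `η` gives to coordinate `i` in
round `t`, from the feedback of the rounds before `t`:
`exp (-(∑_{s=1}^{t-1} g_{s,i} + g_{t-1,i}) / η_t)`. -/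
def omwuWeight {ι : Type*} (η : ℕ → ℝ) (g : ℕ → ι → ℝ) (t : ℕ) (i : ι) : ℝ :=
  Real.exp (-((∑ s ∈ Finset.Ico 1 t, g s i) + g (t - 1) i) / η t)

/-- In every round `t = 1, 2, …` the player plays `x t` by OMWU with the adaptive learning rate,
where `g t` is the feedback of round `t` and `g 0 = 0` by convention. (The value `x 0` is not part
of the play.) -/
structure FollowsAdaptiveOMWU {ι : Type*} [Fintype ι] (N : Seminorm ℝ (ι → ℝ)) (τ : ℝ)
    (g x : ℕ → ι → ℝ) : Prop where
  feedback_zero : g 0 = 0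
  play : ∀ t, 1 ≤ t → ∀ i,
    x t i = omwuWeight (adaptiveRate N τ g) g t i / ∑ j, omwuWeight (adaptiveRate N τ g) g t j

end AdaptiveOMWU

end

/-!
The proof follows one potential along the play. Regularize the loss of a mixed strategy by `η` times
its entropy relative to the uniform distribution. The minimizer of the regularized cumulative loss
is a Gibbs distribution, here called the *leader* of the round, and the minimum is the free energy.
OMWU plays the Gibbs distribution of the cumulative loss corrected by a prediction of the next
loss. Comparing the free energies of consecutive rounds (`freeEnergy_step`) shows that the energy of
a player at `p`, the cumulative loss of `p` minus the free energy, grows by at most minus the regret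
against `p`, plus the squared error of the prediction divided by `η`, minus `η` times relative
entropies that dominate the squared movement of the play. The adaptive rate is built such that the
error term is at most a multiple of the increase of `η` (`exists_energy_succ_le`).

At a saddle point the regrets of the two players add up to something nonnegative. Hence the movement
is bounded by a multiple of the rates; but the squares of the rates are bounded by the movement,
because in a game the prediction error of one player is controlled by the movement of the other. So
the rates converge, the movement is summable, and the joint energy converges at every saddle point
(`exists_rate_le_and_sum_movement_le`, `exists_tendsto_jointEnergy`).

Up to convergent terms the joint energy at `(p, q)` is the weighted sum of the relative entropies
from `(p, q)` to the leaders. If it converges at a cluster point of the leaders, then these entropies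
tend to `0`, as they do along a subsequence, and the leaders, with them the play, converge to the
cluster point. A cluster point is not known to be an equilibrium at this stage, so convergence of
the energy there is obtained indirectly. Take a strictly complementary saddle point, which exists by
Tucker's theorem on skew-symmetric matrices, a consequence of Farkas' lemma (`exists_strict_saddle`).
Bounded relative entropy forces the support of the cluster point to contain that of the saddle point
(`pos_of_cluster`), and since the leaders stop moving, all pure strategies in the support of the
cluster point have the same loss there (`feedback_eq_of_cluster`). By strict complementarity a small
step from the saddle point towards the cluster point then ends in another saddle point
(`IsSaddle.exists_combo`). The joint energy converges at both saddle points and is affine, so it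
converges on the line through them, and in particular at the cluster point (`exists_tendsto_leader`).

Finally the limit is an equilibrium: a pure strategy with a smaller loss in the limit than one in the
support would see its probability grow exponentially relative to it (`feedback_le_of_tendsto`).
-/

namespace AdaptiveOMWU

/-! ### Farkas' lemma and Tucker's theorem on skew-symmetric matrices -/

/-- **Farkas' lemma** for finitely many linear functionals, by induction on their number: if the
last functional `a i` is needed at all, there is a point `z` that witnesses this, and projecting
along `z` onto the kernel of `a i` removes it. -/
theorem farkas {ι V : Type*} [AddCommGroup V] [Module ℝ V] (s : Finset ι) :
    ∀ (a : ι → V →ₗ[ℝ] ℝ) (b : V →ₗ[ℝ] ℝ),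
      (∀ z, (∀ i ∈ s, a i z ≤ 0) → b z ≤ 0) →
        ∃ c : ι → ℝ, (∀ i, 0 ≤ c i) ∧ b = ∑ i ∈ s, c i • a i := by
  classical
  induction s using Finset.induction_on with
  | empty =>
    intro a b h
    refine ⟨0, fun _ => le_rfl, ?_⟩
    ext z
    have h1 := h z (by simp)
    have h2 := h (-z) (by simp)
    simp only [map_neg] at h2
    simp only [Finset.sum_empty, LinearMap.zero_apply]
    linarith
  | insert i s his ih =>
    intro a b h
    by_cases h' : ∀ z, (∀ j ∈ s, a j z ≤ 0) → b z ≤ 0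
    · obtain ⟨c, hc, hb⟩ := ih a b h'
      refine ⟨Function.update c i 0, fun j => ?_, ?_⟩
      · rcases eq_or_ne j i with rfl | hj
        · simp
        · simpa [hj] using hc j
      · rw [Finset.sum_insert his, hb]
        simp only [Function.update_self, zero_smul, zero_add]
        refine Finset.sum_congr rfl fun j hj => ?_
        rw [Function.update_of_ne (by rintro rfl; exact his hj)]
    · push Not at h'
      obtain ⟨z, hz, hbz⟩ := h'
      have haz : 0 < a i z := by
        by_contra! hle
        exact absurd (h z (by simpa [hle] using hz)) (not_le.2 hbz)
      have hne := haz.ne'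
      obtain ⟨c, hc, hb⟩ := ih (fun j => a j - (a j z / a i z) • a i) (b - (b z / a i z) • a i) (by
        intro u hu
        have key := h (u - (a i u / a i z) • z) (by
          intro j hj
          rcases Finset.mem_insert.1 hj with rfl | hj
          · simp only [map_sub, map_smul, smul_eq_mul]
            rw [div_mul_cancel₀ _ hne, sub_self]
          · have := hu j hj
            simp only [map_sub, map_smul, smul_eq_mul, LinearMap.sub_apply,
              LinearMap.smul_apply] at this ⊢
            convert this using 2
            ring)
        simp only [map_sub, map_smul, smul_eq_mul, LinearMap.sub_apply,
          LinearMap.smul_apply] at key ⊢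
        convert key using 2
        ring)
      refine ⟨Function.update c i (b z / a i z - ∑ j ∈ s, c j * (a j z / a i z)), fun j => ?_, ?_⟩
      · rcases eq_or_ne j i with rfl | hj
        · simp only [Function.update_self, sub_nonneg]
          refine (Finset.sum_nonpos fun k hk => ?_).trans (div_pos hbz haz).le
          exact mul_nonpos_of_nonneg_of_nonpos (hc k)
            (div_nonpos_of_nonpos_of_nonneg (hz k hk) haz.le)
        · simpa [hj] using hc j
      · have hs : ∑ j ∈ s, Function.update c i (b z / a i z - ∑ j ∈ s, c j * (a j z / a i z)) j • a j
            = ∑ j ∈ s, c j • a j := by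
          refine Finset.sum_congr rfl fun j hj => ?_
          rw [Function.update_of_ne (by rintro rfl; exact his hj)]
        rw [Finset.sum_insert his, hs, Function.update_self]
        refine (sub_eq_iff_eq_add.1 hb).trans ?_
        have hz' : ∑ j ∈ s, (c j * (a j z / a i z)) • a i =
            (∑ j ∈ s, c j * (a j z / a i z)) • a i := (Finset.sum_smul ..).symm
        simp only [smul_sub, Finset.sum_sub_distrib, smul_smul]
        rw [hz']
        ext u
        simp only [LinearMap.add_apply, LinearMap.sub_apply, LinearMap.smul_apply, smul_eq_mul]
        ring

/-- **Tucker's theorem**: a skew-symmetric matrix `K` admits a vector `w ≥ 0` with `K w ≥ 0` and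
`w + K w > 0`. -/
theorem exists_pos_add_mulVec_of_skew {ι : Type*} [Fintype ι] (K : ι → ι → ℝ)
    (hK : ∀ i j, K i j = -K j i) :
    ∃ w : ι → ℝ, (∀ i, 0 ≤ w i) ∧ (∀ i, 0 ≤ ∑ j, K i j * w j) ∧
      ∀ i, 0 < w i + ∑ j, K i j * w j := by
  classical
  -- It suffices to make one coordinate of `w + K w` positive at a time, and to add up the vectors.
  have key : ∀ i, ∃ w : ι → ℝ, (∀ k, 0 ≤ w k) ∧ (∀ k, 0 ≤ ∑ j, K k j * w j) ∧
      0 < w i + ∑ j, K i j * w j := by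
    intro i
    by_contra! hcon
    let rowMap : ι → (ι → ℝ) →ₗ[ℝ] ℝ := fun k => ∑ j, K k j • LinearMap.proj j
    have hrow : ∀ k z, rowMap k z = ∑ j, K k j * z j := by
      intro k z
      simp [rowMap]
    -- If no `w` works for `i`, then Farkas' lemma writes the `i`-th coordinate as a combination with
    -- coefficients `-c`; by skew symmetry, the coefficients of the rows form such a `w`.
    obtain ⟨c, hc, hb⟩ := farkas (Finset.univ : Finset (ι ⊕ ι))
      (Sum.elim (fun k => -LinearMap.proj k) (fun k => -rowMap k))
      (LinearMap.proj i : (ι → ℝ) →ₗ[ℝ] ℝ) (by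
        intro z hz
        have h1 : ∀ k, 0 ≤ z k := fun k => by simpa using hz (Sum.inl k) (Finset.mem_univ _)
        have h2 : ∀ k, 0 ≤ ∑ j, K k j * z j := fun k => by
          simpa [hrow] using hz (Sum.inr k) (Finset.mem_univ _)
        have := hcon z h1 h2
        simp only [LinearMap.proj_apply]
        linarith [h2 i])
    have hval : ∀ k, ∑ j, K k j * c (Sum.inr j) = (if i = k then 1 else 0) + c (Sum.inl k) := by
      intro k
      have := LinearMap.congr_fun hb (Pi.single k 1)
      simp [Fintype.sum_sum_type, hrow, Pi.single_apply] at this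
      rw [this, add_right_comm, neg_add_cancel, zero_add, ← Finset.sum_neg_distrib]
      refine Finset.sum_congr rfl fun j _ => ?_
      rw [hK k j]; ring
    have h3 := hcon (fun k => c (Sum.inr k)) (fun k => hc _) (fun k => by
      rw [hval]
      have := hc (Sum.inl k)
      split_ifs <;> linarith)
    rw [hval] at h3
    simp only [if_true] at h3
    linarith [hc (Sum.inl i), hc (Sum.inr i)]
  choose w h0 h1 h2 using key
  have hswap : ∀ i, ∑ j, K i j * ∑ k, w k j = ∑ k, ∑ j, K i j * w k j := by
    intro i
    simp only [Finset.mul_sum]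
    exact Finset.sum_comm
  refine ⟨fun i => ∑ k, w k i, fun i => Finset.sum_nonneg fun k _ => h0 k i, fun i => ?_,
    fun i => ?_⟩
  · rw [hswap]
    exact Finset.sum_nonneg fun k _ => h1 k i
  · rw [hswap, ← Finset.sum_add_distrib]
    exact Finset.sum_pos' (fun k _ => add_nonneg (h0 k i) (h1 k i)) ⟨i, Finset.mem_univ _, h2 i⟩

/-! ### Strictly complementary saddle points -/

/-- `(x, y)` is a saddle point with value `v` of the matrix game `A`, in which the row player
minimizes and the column player maximizes. -/
structure IsSaddle {α β : Type*} [Fintype α] [Fintype β] (A : α → β → ℝ) (x : α → ℝ) (y : β → ℝ)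
    (v : ℝ) : Prop where
  left_mem : x ∈ stdSimplex ℝ α
  right_mem : y ∈ stdSimplex ℝ β
  le_row : ∀ a, v ≤ ∑ b, y b * A a b
  col_le : ∀ b, ∑ a, x a * A a b ≤ v

/-- Every matrix game has a saddle point that is *strictly complementary*: the pure strategies
that it does not use are strictly worse than the value. -/
theorem exists_strict_saddle {α β : Type*} [Fintype α] [Nonempty α] [Fintype β] [Nonempty β]
    (A : α → β → ℝ) :
    ∃ x y v, IsSaddle A x y v ∧ (∀ a, x a = 0 → v < ∑ b, y b * A a b) ∧
      ∀ b, y b = 0 → ∑ a, x a * A a b < v := by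
  classical
  -- Shift the entries so that they are all positive.
  obtain ⟨M, hM⟩ : ∃ M, ∀ a b, 0 < A a b + M := by
    obtain ⟨M, hM⟩ := (Set.finite_range fun q : α × β => -A q.1 q.2).bddAbove
    exact ⟨M + 1, fun a b => by linarith [hM ⟨(a, b), rfl⟩]⟩
  -- Tucker's theorem for the rows `A y - t`, `t - Aᵀ x`, `∑ x - ∑ y` in the unknowns `x, y, t`.
  obtain ⟨w, hw, hKw, hpos⟩ := exists_pos_add_mulVec_of_skew
    (ι := (α ⊕ β) ⊕ Unit)
    (Sum.elim
      (Sum.elim (fun a => Sum.elim (Sum.elim (fun _ => 0) (fun b => A a b + M)) (fun _ => -1))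
        (fun b => Sum.elim (Sum.elim (fun a => -(A a b + M)) (fun _ => 0)) (fun _ => 1)))
      (fun _ => Sum.elim (Sum.elim (fun _ => 1) (fun _ => -1)) (fun _ => 0)))
    (by rintro ((a | b) | _) ((a' | b') | _) <;> simp)
  set x : α → ℝ := fun a => w (Sum.inl (Sum.inl a)) with hx
  set y : β → ℝ := fun b => w (Sum.inl (Sum.inr b)) with hy
  set t : ℝ := w (Sum.inr ()) with ht
  have hx0 : ∀ a, 0 ≤ x a := fun a => hw _
  have hy0 : ∀ b, 0 ≤ y b := fun b => hw _
  have ht0 : 0 ≤ t := hw _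
  have hA : ∀ a, t ≤ ∑ b, (A a b + M) * y b := fun a => by
    have := hKw (Sum.inl (Sum.inl a))
    simp [Fintype.sum_sum_type] at this
    linarith
  have hA' : ∀ a, x a = 0 → t < ∑ b, (A a b + M) * y b := fun a ha => by
    have := hpos (Sum.inl (Sum.inl a))
    simp [Fintype.sum_sum_type] at this
    simp only [hx] at ha
    rw [ha] at this
    linarith
  have hB : ∀ b, ∑ a, (A a b + M) * x a ≤ t := fun b => by
    have := hKw (Sum.inl (Sum.inr b))
    simp [Fintype.sum_sum_type, -neg_add_rev] at this
    simpa [neg_mul, Finset.sum_neg_distrib, neg_add_eq_sub] using this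
  have hB' : ∀ b, y b = 0 → ∑ a, (A a b + M) * x a < t := fun b hb => by
    have := hpos (Sum.inl (Sum.inr b))
    simp [Fintype.sum_sum_type, -neg_add_rev] at this
    simp only [hy] at hb
    rw [hb] at this
    simpa [neg_mul, Finset.sum_neg_distrib, neg_add_eq_sub] using this
  have hxy : ∑ b, y b ≤ ∑ a, x a := by
    have := hKw (Sum.inr ())
    simp [Fintype.sum_sum_type] at this
    linarith
  have hlast : 0 < t + (∑ a, x a - ∑ b, y b) := by
    have := hpos (Sum.inr ())
    simp [Fintype.sum_sum_type] at this
    linarith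
  -- If `t = 0`, then `Aᵀ x ≤ 0` forces `x = 0`.
  have htpos : 0 < t := by
    by_contra! hle
    have hxz : ∀ a, x a = 0 := by
      intro a
      obtain ⟨b⟩ := ‹Nonempty β›
      have h1 : (A a b + M) * x a ≤ ∑ a, (A a b + M) * x a :=
        Finset.single_le_sum (f := fun a => (A a b + M) * x a)
          (fun a _ => mul_nonneg (hM a b).le (hx0 a)) (Finset.mem_univ a)
      have h2 := hB b
      nlinarith [hM a b, hx0 a]
    have : ∑ a, x a = 0 := Finset.sum_eq_zero fun a _ => hxz a
    have : 0 ≤ ∑ b, y b := Finset.sum_nonneg fun b _ => hy0 b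
    linarith
  have hY : 0 < ∑ b, y b := by
    rcases (Finset.sum_nonneg fun b (_ : b ∈ Finset.univ) => hy0 b).lt_or_eq with h | h
    · exact h
    · exfalso
      have hyz := (Finset.sum_eq_zero_iff_of_nonneg fun b _ => hy0 b).1 h.symm
      obtain ⟨a⟩ := ‹Nonempty α›
      have := hA a
      rw [Finset.sum_eq_zero fun b hb => by rw [hyz b hb, mul_zero]] at this
      linarith
  -- Both `t ∑ x ≤ xᵀ A y` and `xᵀ A y ≤ t ∑ y`, so the two masses agree.
  have hmass : ∑ a, x a = ∑ b, y b := by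
    refine le_antisymm ?_ hxy
    have h1 : ∑ a, x a * t ≤ ∑ a, x a * ∑ b, (A a b + M) * y b :=
      Finset.sum_le_sum fun a _ => mul_le_mul_of_nonneg_left (hA a) (hx0 a)
    have h2 : ∑ b, y b * ∑ a, (A a b + M) * x a ≤ ∑ b, y b * t :=
      Finset.sum_le_sum fun b _ => mul_le_mul_of_nonneg_left (hB b) (hy0 b)
    have h3 : ∑ a, x a * ∑ b, (A a b + M) * y b = ∑ b, y b * ∑ a, (A a b + M) * x a := by
      simp only [Finset.mul_sum]
      rw [Finset.sum_comm]
      exact Finset.sum_congr rfl fun b _ => Finset.sum_congr rfl fun a _ => by ring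
    rw [← Finset.sum_mul] at h1 h2
    exact le_of_mul_le_mul_right (h1.trans (h3.le.trans h2)) htpos
  set S := ∑ b, y b with hS
  have hrow : ∀ a, ∑ b, y b / S * A a b = (∑ b, (A a b + M) * y b) / S - M := by
    intro a
    have : ∑ b, (A a b + M) * y b = ∑ b, y b * A a b + M * S := by
      rw [hS, Finset.mul_sum, ← Finset.sum_add_distrib]
      exact Finset.sum_congr rfl fun b _ => by ring
    rw [this, add_div, mul_div_cancel_right₀ _ hY.ne', add_sub_cancel_right, Finset.sum_div]
    exact Finset.sum_congr rfl fun b _ => by ring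
  have hcol : ∀ b, ∑ a, x a / S * A a b = (∑ a, (A a b + M) * x a) / S - M := by
    intro b
    have : ∑ a, (A a b + M) * x a = ∑ a, x a * A a b + M * S := by
      rw [← hmass, Finset.mul_sum, ← Finset.sum_add_distrib]
      exact Finset.sum_congr rfl fun b _ => by ring
    rw [this, add_div, mul_div_cancel_right₀ _ hY.ne', add_sub_cancel_right, Finset.sum_div]
    exact Finset.sum_congr rfl fun b _ => by ring
  refine ⟨fun a => x a / S, fun b => y b / S, t / S - M,
    ⟨⟨fun a => by have := hx0 a; positivity, ?_⟩,
    ⟨fun b => by have := hy0 b; positivity, ?_⟩, fun a => ?_, fun b => ?_⟩, fun a ha => ?_,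
    fun b hb => ?_⟩
  · rw [← Finset.sum_div, hmass, div_self hY.ne']
  · rw [← Finset.sum_div, div_self hY.ne']
  · rw [hrow]; gcongr; exact hA a
  · rw [hcol]; gcongr; exact hB b
  · rw [hrow]; gcongr; exact hA' a (by simpa [hY.ne'] using ha)
  · rw [hcol]; gcongr; exact hB' b (by simpa [hY.ne'] using hb)

/-! ### Gibbs distributions and relative entropy -/

/-- The Gibbs distribution of the losses `v` at temperature `η`. -/
noncomputable def gibbs {ι : Type*} [Fintype ι] (η : ℝ) (v : ι → ℝ) (i : ι) : ℝ :=
  Real.exp (-v i / η) / ∑ j, Real.exp (-v j / η)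

/-- The relative entropy `∑ i, p i * log (p i / q i)`, for `q` with positive entries. -/
noncomputable def kl {ι : Type*} [Fintype ι] (p q : ι → ℝ) : ℝ :=
  ∑ i, p i * (Real.log (p i) - Real.log (q i))

/-- The entropy of `p` relative to the uniform distribution. -/
noncomputable def relEntropy {ι : Type*} [Fintype ι] (p : ι → ℝ) : ℝ :=
  Real.log (Fintype.card ι) + ∑ i, p i * Real.log (p i)

/-- The free energy of the losses `v` at temperature `η`: the minimum of
`∑ i, v i * p i + η * relEntropy p` over the mixed strategies `p`, see
`sum_mul_add_relEntropy_eq`. -/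
noncomputable def freeEnergy {ι : Type*} [Fintype ι] (η : ℝ) (v : ι → ℝ) : ℝ :=
  η * (Real.log (Fintype.card ι) - Real.log (∑ j, Real.exp (-v j / η)))

section Gibbs

variable {ι : Type*} [Fintype ι]

theorem mem_stdSimplex_le_one {p : ι → ℝ} (hp : p ∈ stdSimplex ℝ ι) (i : ι) : p i ≤ 1 := by
  rw [← hp.2]
  exact Finset.single_le_sum (fun j _ => hp.1 j) (Finset.mem_univ i)

theorem relEntropy_le {p : ι → ℝ} (hp : p ∈ stdSimplex ℝ ι) :
    relEntropy p ≤ Real.log (Fintype.card ι) := by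
  rw [relEntropy, add_le_iff_nonpos_right]
  exact Finset.sum_nonpos fun i _ =>
    mul_nonpos_of_nonneg_of_nonpos (hp.1 i)
      (Real.log_nonpos (hp.1 i) (mem_stdSimplex_le_one hp i))

/-- A weak form of Pinsker's inequality, which passes through the Hellinger distance. -/
theorem sum_sq_sub_le_kl {p q : ι → ℝ} (hp : p ∈ stdSimplex ℝ ι) (hq : q ∈ stdSimplex ℝ ι)
    (hq0 : ∀ i, 0 < q i) : 1 / 4 * ∑ i, (p i - q i) ^ 2 ≤ kl p q := by
  -- With `p i = s²` and `q i = r²`, the entropy term is at least `2 s² - 2 s r`, by `log u ≤ u - 1`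
  -- at `u = r / s`.
  have key : ∀ i, 1 / 4 * (p i - q i) ^ 2 + p i - q i ≤
      p i * (Real.log (p i) - Real.log (q i)) := by
    intro i
    have hp0 := hp.1 i
    have hp1 := mem_stdSimplex_le_one hp i
    have hq1 := mem_stdSimplex_le_one hq i
    have hqi := hq0 i
    obtain ⟨s, hs, hps⟩ : ∃ s, 0 ≤ s ∧ p i = s ^ 2 :=
      ⟨√(p i), Real.sqrt_nonneg _, (Real.sq_sqrt hp0).symm⟩
    obtain ⟨r, hr, hqr⟩ : ∃ r, 0 < r ∧ q i = r ^ 2 :=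
      ⟨√(q i), Real.sqrt_pos.2 hqi, (Real.sq_sqrt hqi.le).symm⟩
    rw [hps] at hp1
    rw [hqr] at hq1
    rw [hps, hqr]
    have hs1 : s ≤ 1 := by nlinarith
    have hr1 : r ≤ 1 := by nlinarith
    -- `(s² - r²)² / 4 ≤ (s - r)² = s² + r² - 2 s r`, because `s + r ≤ 2`.
    have h1 : 1 / 4 * (s ^ 2 - r ^ 2) ^ 2 ≤ (s - r) ^ 2 := by
      have : (s + r) ^ 2 ≤ 4 := by nlinarith
      have := mul_le_mul_of_nonneg_left this (sq_nonneg (s - r))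
      nlinarith
    have h2 : 2 * s ^ 2 - 2 * s * r ≤ s ^ 2 * (Real.log (s ^ 2) - Real.log (r ^ 2)) := by
      rcases hs.eq_or_lt with rfl | hs
      · simp
      · have h3 := Real.log_le_sub_one_of_pos (div_pos hr hs)
        rw [Real.log_div hr.ne' hs.ne'] at h3
        rw [Real.log_pow, Real.log_pow]
        have h4 := mul_le_mul_of_nonneg_left h3 (by positivity : (0 : ℝ) ≤ 2 * s ^ 2)
        have h5 : 2 * s ^ 2 * (r / s - 1) = 2 * s * r - 2 * s ^ 2 := by field_simp
        push_cast
        linarith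
    nlinarith
  calc 1 / 4 * ∑ i, (p i - q i) ^ 2
      = ∑ i, (1 / 4 * (p i - q i) ^ 2 + p i - q i) := by
        rw [Finset.sum_sub_distrib, Finset.sum_add_distrib, hp.2, hq.2, Finset.mul_sum]
        ring
    _ ≤ kl p q := Finset.sum_le_sum fun i _ => key i

theorem kl_nonneg {p q : ι → ℝ} (hp : p ∈ stdSimplex ℝ ι) (hq : q ∈ stdSimplex ℝ ι)
    (hq0 : ∀ i, 0 < q i) : 0 ≤ kl p q :=
  le_trans (by positivity) (sum_sq_sub_le_kl hp hq hq0)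

variable [Nonempty ι]

theorem sum_exp_pos (v : ι → ℝ) (η : ℝ) : 0 < ∑ j, Real.exp (-v j / η) :=
  Finset.sum_pos (fun _ _ => Real.exp_pos _) Finset.univ_nonempty

theorem gibbs_pos (η : ℝ) (v : ι → ℝ) (i : ι) : 0 < gibbs η v i :=
  div_pos (Real.exp_pos _) (sum_exp_pos v η)

theorem gibbs_mem (η : ℝ) (v : ι → ℝ) : gibbs η v ∈ stdSimplex ℝ ι := by
  refine ⟨fun i => (gibbs_pos η v i).le, ?_⟩
  simp only [gibbs, ← Finset.sum_div]
  exact div_self (sum_exp_pos v η).ne'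

theorem log_gibbs (η : ℝ) (v : ι → ℝ) (i : ι) :
    Real.log (gibbs η v i) = -v i / η - Real.log (∑ j, Real.exp (-v j / η)) := by
  rw [gibbs, Real.log_div (Real.exp_pos _).ne' (sum_exp_pos v η).ne', Real.log_exp]

/-- Up to the free energy, the regularized loss of `p` is its relative entropy to the Gibbs
distribution. -/
theorem sum_mul_add_relEntropy_eq {η : ℝ} (hη : 0 < η) (v : ι → ℝ) {p : ι → ℝ}
    (hp : ∑ i, p i = 1) :
    ∑ i, v i * p i + η * relEntropy p = freeEnergy η v + η * kl p (gibbs η v) := by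
  have h : kl p (gibbs η v) = ∑ i, p i * Real.log (p i) + (∑ i, v i * p i) / η
      + Real.log (∑ j, Real.exp (-v j / η)) := by
    have h1 : Real.log (∑ j, Real.exp (-v j / η)) =
        ∑ i, p i * Real.log (∑ j, Real.exp (-v j / η)) := by
      rw [← Finset.sum_mul, hp, one_mul]
    rw [h1, Finset.sum_div, ← Finset.sum_add_distrib, ← Finset.sum_add_distrib, kl]
    refine Finset.sum_congr rfl fun i _ => ?_
    rw [log_gibbs]
    ring
  rw [h, relEntropy, freeEnergy]
  field_simp
  ring

theorem relEntropy_nonneg {p : ι → ℝ} (hp : p ∈ stdSimplex ℝ ι) : 0 ≤ relEntropy p := by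
  have h := sum_mul_add_relEntropy_eq one_pos (0 : ι → ℝ) hp.2
  have hf : freeEnergy 1 (0 : ι → ℝ) = 0 := by simp [freeEnergy]
  rw [hf] at h
  have := kl_nonneg hp (gibbs_mem 1 (0 : ι → ℝ)) (gibbs_pos _ _)
  simp at h
  linarith

/-- One step of optimistic mirror descent with the prediction `m` of the loss `g`: the leader `X`
becomes `X'`, and `x` is played in between. -/
theorem freeEnergy_step {η η' : ℝ} (hη : 0 < η) (hηη' : η ≤ η') (v m g : ι → ℝ) :
    freeEnergy η v + ∑ i, g i * gibbs η (v + m) i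
        - ∑ i, (g i - m i) * (gibbs η (v + m) i - gibbs η' (v + g) i)
        + η * kl (gibbs η' (v + g)) (gibbs η (v + m)) + η * kl (gibbs η (v + m)) (gibbs η v)
      ≤ freeEnergy η' (v + g) := by
  set x := gibbs η (v + m)
  set X' := gibbs η' (v + g)
  have hx : x ∈ stdSimplex ℝ ι := gibbs_mem _ _
  have hX' : X' ∈ stdSimplex ℝ ι := gibbs_mem _ _
  have h1 := sum_mul_add_relEntropy_eq (hη.trans_le hηη') (v + g) hX'.2
  have h2 := sum_mul_add_relEntropy_eq hη (v + m) hX'.2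
  have h3 := sum_mul_add_relEntropy_eq hη (v + m) hx.2
  have h4 := sum_mul_add_relEntropy_eq hη v hx.2
  have h5 : kl X' (gibbs η' (v + g)) = 0 := by simp [kl, X']
  have h6 : kl x (gibbs η (v + m)) = 0 := by simp [kl, x]
  have h7 := mul_le_mul_of_nonneg_right hηη' (relEntropy_nonneg hX')
  rw [h5, mul_zero, add_zero] at h1
  rw [h6, mul_zero, add_zero] at h3
  simp only [Pi.add_apply, add_mul, sub_mul, mul_sub, Finset.sum_add_distrib,
    Finset.sum_sub_distrib] at h1 h2 h3 ⊢
  linarith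

end Gibbs

/-! ### The dual norm -/

/-- In finite dimension, the dual norm is equivalent to the Euclidean norm. -/
theorem exists_dualNorm_sq_bounds {ι : Type*} [Fintype ι] (N : Seminorm ℝ (ι → ℝ))
    (hN : ∀ v, N v = 0 → v = 0) :
    ∃ c > 0, ∃ C, 0 ≤ C ∧ ∀ v, 0 ≤ dualNorm N v ∧
      c * ∑ i, v i ^ 2 ≤ dualNorm N v ^ 2 ∧ dualNorm N v ^ 2 ≤ C * ∑ i, v i ^ 2 := by
  classical
  -- `N` is bounded by a multiple `K` of the Euclidean norm.
  obtain ⟨K, hK, hNK⟩ : ∃ K > 0, ∀ v, N v ^ 2 ≤ K * ∑ i, v i ^ 2 := by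
    refine ⟨∑ i, N (Pi.single i 1) ^ 2 + 1, by positivity, fun v => ?_⟩
    have h1 : N v ≤ ∑ i, |v i| * N (Pi.single i 1) := by
      conv_lhs => rw [show v = ∑ i, v i • (Pi.single i 1 : ι → ℝ) by
        ext j; simp [Finset.sum_apply, Pi.single_apply]]
      refine (Finset.le_sum_of_subadditive N (map_zero N).le (map_add_le_add N) _ _).trans
        (Finset.sum_le_sum fun i _ => ?_)
      rw [map_smul_eq_mul, Real.norm_eq_abs]
    have h2 := Finset.sum_mul_sq_le_sq_mul_sq Finset.univ (fun i => |v i|)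
      (fun i => N (Pi.single i 1))
    have h3 : N v ^ 2 ≤ (∑ i, |v i| * N (Pi.single i 1)) ^ 2 :=
      pow_le_pow_left₀ (apply_nonneg N v) h1 2
    simp only [sq_abs] at h2
    have h4 : 0 ≤ ∑ i, v i ^ 2 := by positivity
    nlinarith
  have hcont : Continuous N := by
    refine Seminorm.continuous_of_continuousAt_zero ?_
    rw [ContinuousAt, map_zero]
    have hlim : Tendsto (fun v : ι → ℝ => √(K * ∑ i, v i ^ 2)) (𝓝 0) (𝓝 0) := by
      have : Continuous fun v : ι → ℝ => √(K * ∑ i, v i ^ 2) := by fun_prop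
      simpa using this.tendsto 0
    exact squeeze_zero (fun v => apply_nonneg N v) (fun v => Real.le_sqrt_of_sq_le (hNK v)) hlim
  -- By compactness of the unit sphere, the unit ball of `N` is bounded.
  obtain ⟨R, hR, hball⟩ : ∃ R, 0 ≤ R ∧ ∀ u, N u ≤ 1 → ‖u‖ ≤ R := by
    rcases isEmpty_or_nonempty ι with hι | hι
    · exact ⟨0, le_rfl, fun u _ => by simp [Subsingleton.elim u 0]⟩
    · have hne : (Metric.sphere (0 : ι → ℝ) 1).Nonempty :=
        NormedSpace.sphere_nonempty.2 zero_le_one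
      obtain ⟨z, hz, hmin⟩ := (isCompact_sphere (0 : ι → ℝ) 1).exists_isMinOn hne
        hcont.continuousOn
      have hz1 : ‖z‖ = 1 := by simpa using hz
      have hNz : 0 < N z := (apply_nonneg N z).lt_of_ne' fun h => by
        rw [hN z h, norm_zero] at hz1
        exact zero_ne_one hz1
      refine ⟨(N z)⁻¹, by positivity, fun u hu => ?_⟩
      rcases eq_or_ne u 0 with rfl | hu0
      · rw [norm_zero]; positivity
      · have hun : 0 < ‖u‖ := norm_pos_iff.2 hu0
        have h1 : N z ≤ N (‖u‖⁻¹ • u) := hmin (by simp [norm_smul, hun.ne'])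
        rw [map_smul_eq_mul, norm_inv, norm_norm] at h1
        rw [← one_div, le_div_iff₀ hNz]
        have h2 := mul_le_mul_of_nonneg_left h1 hun.le
        rw [mul_inv_cancel_left₀ hun.ne'] at h2
        linarith
  have hbound : ∀ v u : ι → ℝ, N u ≤ 1 → ∑ i, v i * u i ≤ R * ∑ i, |v i| := by
    intro v u hu
    rw [Finset.mul_sum]
    refine Finset.sum_le_sum fun i _ => ?_
    have h1 : |u i| ≤ R := (norm_le_pi_norm u i).trans (hball u hu)
    calc v i * u i ≤ |v i * u i| := le_abs_self _
      _ = |u i| * |v i| := by rw [abs_mul, mul_comm]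
      _ ≤ R * |v i| := by gcongr
  have hbdd : ∀ v : ι → ℝ, BddAbove {r : ℝ | ∃ u : ι → ℝ, N u ≤ 1 ∧ r = ∑ i, v i * u i} := fun v =>
    ⟨R * ∑ i, |v i|, by rintro _ ⟨u, hu, rfl⟩; exact hbound v u hu⟩
  have hnonneg : ∀ v, 0 ≤ dualNorm N v := fun v => le_csSup (hbdd v) ⟨0, by simp, by simp⟩
  refine ⟨1 / K, by positivity, R ^ 2 * Fintype.card ι, by positivity, fun v =>
    ⟨hnonneg v, ?_, ?_⟩⟩
  · rcases (apply_nonneg N v).eq_or_lt with h0 | h0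
    · rw [hN v h0.symm]
      simp only [Pi.zero_apply, ne_eq, OfNat.ofNat_ne_zero, not_false_eq_true, zero_pow,
        Finset.sum_const_zero, mul_zero]
      positivity
    · have h1 : (∑ i, v i ^ 2) / N v ≤ dualNorm N v := by
        refine le_csSup (hbdd v) ⟨(N v)⁻¹ • v, ?_, ?_⟩
        · rw [map_smul_eq_mul, norm_inv, Real.norm_of_nonneg h0.le, inv_mul_cancel₀ h0.ne']
        · rw [Finset.sum_div]
          refine Finset.sum_congr rfl fun i _ => ?_
          simp only [Pi.smul_apply, smul_eq_mul]
          ring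
      have hS : 0 ≤ ∑ i, v i ^ 2 := by positivity
      refine le_trans ?_ (pow_le_pow_left₀ (div_nonneg hS h0.le) h1 2)
      rw [div_pow, le_div_iff₀ (by positivity), one_div, mul_right_comm, inv_mul_eq_div,
        div_mul_eq_mul_div, div_le_iff₀ hK]
      nlinarith [mul_le_mul_of_nonneg_right (hNK v) hS]
  · have h1 : dualNorm N v ≤ R * ∑ i, |v i| :=
      csSup_le ⟨0, 0, by simp, by simp⟩ (by rintro _ ⟨u, hu, rfl⟩; exact hbound v u hu)
    have h2 := pow_le_pow_left₀ (hnonneg v) h1 2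
    have h3 := sq_sum_le_card_mul_sum_sq (s := Finset.univ) (f := fun i => |v i|)
    simp only [sq_abs, Finset.card_univ] at h3
    rw [mul_pow] at h2
    rw [mul_assoc]
    exact h2.trans (by gcongr)

/-! ### The energy of one player -/

/-- The cumulative loss of the rounds before `t`. -/
def cumLoss {ι : Type*} (g : ℕ → ι → ℝ) (t : ℕ) : ι → ℝ :=
  ∑ s ∈ Finset.Ico 1 t, g s

/-- The strategy that multiplicative weights without optimism would play in round `t`. -/
noncomputable def leader {ι : Type*} [Fintype ι] (η : ℕ → ℝ) (g : ℕ → ι → ℝ) (t : ℕ) : ι → ℝ :=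
  gibbs (η t) (cumLoss g t)

/-- The excess of the cumulative loss of `p` over the free energy. Adding the entropy term
`η t * relEntropy p` turns it into `η t * kl p (leader η g t)`; without that term it is affine
in `p`. -/
noncomputable def energy {ι : Type*} [Fintype ι] (η : ℕ → ℝ) (g : ℕ → ι → ℝ) (t : ℕ)
    (p : ι → ℝ) : ℝ :=
  ∑ i, cumLoss g t i * p i - freeEnergy (η t) (cumLoss g t)

/-- The squared length of the path from the leader of round `t` through the strategy played in
round `t` to the leader of round `t + 1`. -/
noncomputable def movement {ι : Type*} [Fintype ι] (η : ℕ → ℝ) (g x : ℕ → ι → ℝ) (t : ℕ) : ℝ :=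
  ∑ i, (x t i - leader η g t i) ^ 2 + ∑ i, (x t i - leader η g (t + 1) i) ^ 2

section OnePlayer

variable {ι : Type*}

theorem cumLoss_succ (g : ℕ → ι → ℝ) {t : ℕ} (ht : 1 ≤ t) :
    cumLoss g (t + 1) = cumLoss g t + g t :=
  Finset.sum_Ico_succ_top ht g

variable [Fintype ι]

theorem adaptiveRate_mono (N : Seminorm ℝ (ι → ℝ)) (τ : ℝ) (g : ℕ → ι → ℝ) :
    Monotone (adaptiveRate N τ g) := fun s t hst => by
  refine Real.sqrt_le_sqrt (add_le_add_right ?_ _)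
  exact Finset.sum_le_sum_of_subset_of_nonneg (Finset.Ico_subset_Ico_right hst)
    fun _ _ _ => sq_nonneg _

theorem sqrt_le_adaptiveRate (N : Seminorm ℝ (ι → ℝ)) (τ : ℝ) (g : ℕ → ι → ℝ) (t : ℕ) :
    √τ ≤ adaptiveRate N τ g t :=
  Real.sqrt_le_sqrt (le_add_of_nonneg_right (Finset.sum_nonneg fun _ _ => sq_nonneg _))

theorem adaptiveRate_succ_sq (N : Seminorm ℝ (ι → ℝ)) {τ : ℝ} (hτ : 0 < τ) (g : ℕ → ι → ℝ) {t : ℕ}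
    (ht : 1 ≤ t) :
    adaptiveRate N τ g (t + 1) ^ 2 =
      adaptiveRate N τ g t ^ 2 + dualNorm N (g t - g (t - 1)) ^ 2 := by
  have h : ∀ t, 0 ≤ τ + ∑ s ∈ Finset.Ico 1 t, dualNorm N (g s - g (s - 1)) ^ 2 := fun t =>
    add_nonneg hτ.le (Finset.sum_nonneg fun _ _ => sq_nonneg _)
  rw [adaptiveRate, adaptiveRate, Real.sq_sqrt (h _), Real.sq_sqrt (h _),
    Finset.sum_Ico_succ_top ht, add_assoc]

theorem movement_nonneg (η : ℕ → ℝ) (g x : ℕ → ι → ℝ) (t : ℕ) : 0 ≤ movement η g x t := by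
  rw [movement]; positivity

theorem FollowsAdaptiveOMWU.eq_gibbs {N : Seminorm ℝ (ι → ℝ)} {τ : ℝ} {g x : ℕ → ι → ℝ}
    (h : FollowsAdaptiveOMWU N τ g x) {t : ℕ} (ht : 1 ≤ t) :
    x t = gibbs (adaptiveRate N τ g t) (cumLoss g t + g (t - 1)) := by
  ext i
  simp only [h.play t ht i, gibbs, omwuWeight, cumLoss, Pi.add_apply, Finset.sum_apply]

theorem energy_one (η : ℕ → ℝ) (g : ℕ → ι → ℝ) (p : ι → ℝ) : energy η g 1 p = 0 := by
  simp [energy, cumLoss, freeEnergy]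

theorem energy_combo (η : ℕ → ℝ) (g : ℕ → ι → ℝ) (t : ℕ) (p q : ι → ℝ) (ε : ℝ) :
    energy η g t (fun i => (1 - ε) * p i + ε * q i) =
      (1 - ε) * energy η g t p + ε * energy η g t q := by
  have : ∑ i, cumLoss g t i * ((1 - ε) * p i + ε * q i) =
      (1 - ε) * ∑ i, cumLoss g t i * p i + ε * ∑ i, cumLoss g t i * q i := by
    rw [Finset.mul_sum, Finset.mul_sum, ← Finset.sum_add_distrib]
    exact Finset.sum_congr rfl fun i _ => by ring
  rw [energy, energy, energy, this]
  ring

variable [Nonempty ι]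

theorem leader_pos (η : ℕ → ℝ) (g : ℕ → ι → ℝ) (t : ℕ) (i : ι) : 0 < leader η g t i :=
  gibbs_pos _ _ _

theorem leader_mem (η : ℕ → ℝ) (g : ℕ → ι → ℝ) (t : ℕ) : leader η g t ∈ stdSimplex ℝ ι :=
  gibbs_mem _ _

theorem energy_add_relEntropy {η : ℕ → ℝ} (g : ℕ → ι → ℝ) {t : ℕ} (hη : 0 < η t) {p : ι → ℝ}
    (hp : p ∈ stdSimplex ℝ ι) :
    energy η g t p + η t * relEntropy p = η t * kl p (leader η g t) := by
  have := sum_mul_add_relEntropy_eq hη (cumLoss g t) hp.2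
  rw [energy, leader]
  linarith

theorem neg_le_energy {η : ℕ → ℝ} (g : ℕ → ι → ℝ) {t : ℕ} (hη : 0 < η t) {p : ι → ℝ}
    (hp : p ∈ stdSimplex ℝ ι) : -(Real.log (Fintype.card ι) * η t) ≤ energy η g t p := by
  have h1 := energy_add_relEntropy g hη hp
  have h2 := mul_nonneg hη.le (kl_nonneg hp (leader_mem η g t) (leader_pos η g t))
  have h3 := mul_le_mul_of_nonneg_left (relEntropy_le hp) hη.le
  linarith

theorem adaptiveRate_mul_log_leader_sub (N : Seminorm ℝ (ι → ℝ)) {τ : ℝ} (hτ : 0 < τ)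
    (g : ℕ → ι → ℝ) (t : ℕ) (i j : ι) :
    adaptiveRate N τ g t * (Real.log (leader (adaptiveRate N τ g) g t i) -
      Real.log (leader (adaptiveRate N τ g) g t j)) = cumLoss g t j - cumLoss g t i := by
  have := ((Real.sqrt_pos.2 hτ).trans_le (sqrt_le_adaptiveRate N τ g t)).ne'
  rw [leader, log_gibbs, log_gibbs]
  field_simp
  ring

/-- The energy inequality: the learning rate adapts to the errors of the predictions, so that they
cost no more than its increase. -/
theorem FollowsAdaptiveOMWU.exists_energy_succ_le {N : Seminorm ℝ (ι → ℝ)}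
    (hN : ∀ v, N v = 0 → v = 0) {τ : ℝ} (hτ : 0 < τ) {g x : ℕ → ι → ℝ}
    (h : FollowsAdaptiveOMWU N τ g x) {B : ℝ} (hB : ∀ t i, |g t i| ≤ B) :
    ∃ C, 0 ≤ C ∧ ∃ c > 0, ∀ t, 1 ≤ t → ∀ p : ι → ℝ,
      energy (adaptiveRate N τ g) g (t + 1) p + ∑ i, g t i * (x t i - p i) ≤
        energy (adaptiveRate N τ g) g t p
          + C * (adaptiveRate N τ g (t + 1) - adaptiveRate N τ g t)
          - c * movement (adaptiveRate N τ g) g x t := by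
  obtain ⟨c₀, hc₀, C₀, hC₀, hdual⟩ := exists_dualNorm_sq_bounds N hN
  set η := adaptiveRate N τ g with hη
  have hτ' : 0 < √τ := Real.sqrt_pos.2 hτ
  have hηpos : ∀ t, √τ ≤ η t := sqrt_le_adaptiveRate N τ g
  obtain ⟨D, hD, hdiff⟩ : ∃ D, 0 ≤ D ∧ ∀ t, dualNorm N (g t - g (t - 1)) ^ 2 ≤ D ^ 2 := by
    refine ⟨√(C₀ * ∑ _i : ι, (2 * B) ^ 2), Real.sqrt_nonneg _, fun t => ?_⟩
    rw [Real.sq_sqrt (by positivity)]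
    refine (hdual _).2.2.trans (mul_le_mul_of_nonneg_left (Finset.sum_le_sum fun i _ => ?_) hC₀)
    have h1 := abs_le.1 (hB t i)
    have h2 := abs_le.1 (hB (t - 1) i)
    rw [Pi.sub_apply]
    exact sq_le_sq' (by linarith) (by linarith)
  refine ⟨2 * ((2 + D / √τ) / c₀), by positivity, √τ / 8, by positivity, fun t ht p => ?_⟩
  have hηt : 0 < η t := hτ'.trans_le (hηpos t)
  have hmono : η t ≤ η (t + 1) := adaptiveRate_mono N τ g (Nat.le_succ t)
  have hsq : η (t + 1) ^ 2 = η t ^ 2 + dualNorm N (g t - g (t - 1)) ^ 2 :=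
    adaptiveRate_succ_sq N hτ g ht
  -- `η t` does not yet account for the error of round `t`; as the errors are bounded by `D`, it is
  -- still comparable to `η (t + 1)`.
  have hsucc : η (t + 1) ≤ η t + D := by
    refine le_of_sq_le_sq ?_ (by positivity)
    nlinarith [hdiff t, mul_nonneg hηt.le hD]
  -- The squared error of the prediction, relative to `η t`, is bounded by the increase of `η`.
  have herr : ∑ i, (g t i - g (t - 1) i) ^ 2 ≤
      (2 + D / √τ) / c₀ * η t * (η (t + 1) - η t) := by
    have h1 : η (t + 1) + η t ≤ (2 + D / √τ) * η t := by
      have : D ≤ D / √τ * η t := by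
        rw [div_mul_eq_mul_div, le_div_iff₀ hτ']
        exact mul_le_mul_of_nonneg_left (hηpos t) hD
      linarith
    have h2 := (hdual (g t - g (t - 1))).2.1
    simp only [Pi.sub_apply] at h2
    have h3 : dualNorm N (g t - g (t - 1)) ^ 2 ≤ (2 + D / √τ) * η t * (η (t + 1) - η t) := by
      have := mul_le_mul_of_nonneg_right h1 (sub_nonneg.2 hmono)
      nlinarith
    rw [div_mul_eq_mul_div, div_mul_eq_mul_div, le_div_iff₀ hc₀]
    linarith
  have hstep := freeEnergy_step hηt hmono (cumLoss g t) (g (t - 1)) (g t)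
  rw [← cumLoss_succ g ht, ← h.eq_gibbs ht] at hstep
  change _ - ∑ i, (g t i - g (t - 1) i) * (x t i - leader η g (t + 1) i)
    + η t * kl (leader η g (t + 1)) (x t) + η t * kl (x t) (leader η g t) ≤ _ at hstep
  have hxmem : x t ∈ stdSimplex ℝ ι := by rw [h.eq_gibbs ht]; exact gibbs_mem _ _
  have hxpos : ∀ i, 0 < x t i := by rw [h.eq_gibbs ht]; exact gibbs_pos _ _
  have hk1 := mul_le_mul_of_nonneg_left
    (sum_sq_sub_le_kl (leader_mem η g (t + 1)) hxmem hxpos) hηt.le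
  have hk2 := mul_le_mul_of_nonneg_left
    (sum_sq_sub_le_kl hxmem (leader_mem η g t) (leader_pos η g t)) hηt.le
  have hcomm : ∑ i, (leader η g (t + 1) i - x t i) ^ 2 = ∑ i, (x t i - leader η g (t + 1) i) ^ 2 :=
    Finset.sum_congr rfl fun i _ => by ring
  rw [hcomm] at hk1
  have hyoung : ∑ i, (g t i - g (t - 1) i) * (x t i - leader η g (t + 1) i) ≤
      2 / η t * ∑ i, (g t i - g (t - 1) i) ^ 2
        + η t / 8 * ∑ i, (x t i - leader η g (t + 1) i) ^ 2 := by
    rw [Finset.mul_sum, Finset.mul_sum, ← Finset.sum_add_distrib]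
    refine Finset.sum_le_sum fun i _ => ?_
    generalize g t i - g (t - 1) i = a
    generalize x t i - leader η g (t + 1) i = b
    have h1 : 2 / η t * a ^ 2 + η t / 8 * b ^ 2 - a * b =
        2 / η t * (a - η t / 4 * b) ^ 2 := by
      field_simp
      ring
    have h2 : 0 ≤ 2 / η t * (a - η t / 4 * b) ^ 2 := by positivity
    linarith
  have herr' : 2 / η t * ∑ i, (g t i - g (t - 1) i) ^ 2 ≤
      2 * ((2 + D / √τ) / c₀) * (η (t + 1) - η t) := by
    refine (mul_le_mul_of_nonneg_left herr (by positivity)).trans_eq ?_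
    field_simp
  have hmul : √τ / 8 * movement η g x t ≤ η t / 8 * ∑ i, (x t i - leader η g (t + 1) i) ^ 2
      + η t / 4 * ∑ i, (x t i - leader η g t i) ^ 2 := by
    have h1 : 0 ≤ ∑ i, (x t i - leader η g (t + 1) i) ^ 2 := by positivity
    have h2 : 0 ≤ ∑ i, (x t i - leader η g t i) ^ 2 := by positivity
    rw [movement]
    nlinarith [mul_le_mul_of_nonneg_right (hηpos t) h1, mul_le_mul_of_nonneg_right (hηpos t) h2]
  have hlin : ∑ i, cumLoss g (t + 1) i * p i =
      ∑ i, cumLoss g t i * p i + ∑ i, g t i * p i := by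
    rw [cumLoss_succ g ht, ← Finset.sum_add_distrib]
    exact Finset.sum_congr rfl fun i _ => by rw [Pi.add_apply, add_mul]
  have hreg : ∑ i, g t i * (x t i - p i) = ∑ i, g t i * x t i - ∑ i, g t i * p i := by
    rw [← Finset.sum_sub_distrib]
    exact Finset.sum_congr rfl fun i _ => by ring
  rw [energy, energy, hlin, hreg]
  linarith

end OnePlayer

/-! ### Boundedness of the learning rates -/

/-- Both players of the zero-sum game with loss matrix `A` for the row player follow adaptive
OMWU. -/
structure IsPlay {α β : Type*} [Fintype α] [Fintype β] (A : α → β → ℝ)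
    (N₁ : Seminorm ℝ (α → ℝ)) (N₂ : Seminorm ℝ (β → ℝ)) (τ₁ τ₂ : ℝ)
    (g₁ x : ℕ → α → ℝ) (g₂ y : ℕ → β → ℝ) : Prop where
  norm_left : ∀ v, N₁ v = 0 → v = 0
  norm_right : ∀ v, N₂ v = 0 → v = 0
  pos_left : 0 < τ₁
  pos_right : 0 < τ₂
  feedback_left : ∀ t, 1 ≤ t → ∀ a, g₁ t a = ∑ b, y t b * A a b
  feedback_right : ∀ t, 1 ≤ t → ∀ b, g₂ t b = ∑ a, x t a * -A a b
  follows_left : FollowsAdaptiveOMWU N₁ τ₁ g₁ x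
  follows_right : FollowsAdaptiveOMWU N₂ τ₂ g₂ y

theorem tendsto_zero_of_sum_sq_le {ι : Type*} [Fintype ι] {u : ℕ → ι → ℝ} {f : ℕ → ℝ}
    (hu : ∀ t, ∑ i, u t i ^ 2 ≤ f t) (hf : Tendsto f atTop (𝓝 0)) : Tendsto u atTop (𝓝 0) := by
  refine tendsto_pi_nhds.2 fun i => ?_
  have h1 : Tendsto (fun t => u t i ^ 2) atTop (𝓝 0) :=
    squeeze_zero (fun t => sq_nonneg _) (fun t => (Finset.single_le_sum
      (f := fun i => u t i ^ 2) (fun i _ => sq_nonneg _) (Finset.mem_univ i)).trans (hu t)) hf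
  have h2 := h1.sqrt
  rw [Real.sqrt_zero] at h2
  simp only [Real.sqrt_sq_eq_abs] at h2
  exact (tendsto_zero_iff_abs_tendsto_zero _).2 h2

section TwoPlayers

variable {α β : Type*} [Fintype α] [Fintype β]

theorem sum_sum_neg_swap (A : α → β → ℝ) (p : α → ℝ) (q : β → ℝ) :
    ∑ b, q b * ∑ a, p a * -A a b = -∑ a, p a * ∑ b, q b * A a b := by
  simp only [Finset.mul_sum, ← Finset.sum_neg_distrib]
  rw [Finset.sum_comm]
  exact Finset.sum_congr rfl fun a _ => Finset.sum_congr rfl fun b _ => by ring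

variable {A : α → β → ℝ} {N₁ : Seminorm ℝ (α → ℝ)} {N₂ : Seminorm ℝ (β → ℝ)} {τ₁ τ₂ : ℝ}
  {g₁ x : ℕ → α → ℝ} {g₂ y : ℕ → β → ℝ}

theorem IsPlay.symm (h : IsPlay A N₁ N₂ τ₁ τ₂ g₁ x g₂ y) :
    IsPlay (fun b a => -A a b) N₂ N₁ τ₂ τ₁ g₂ y g₁ x where
  norm_left := h.norm_right
  norm_right := h.norm_left
  pos_left := h.pos_right
  pos_right := h.pos_left
  feedback_left := h.feedback_right
  feedback_right := by simpa using h.feedback_left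
  follows_left := h.follows_right
  follows_right := h.follows_left

theorem IsPlay.rate_pos (h : IsPlay A N₁ N₂ τ₁ τ₂ g₁ x g₂ y) (t : ℕ) :
    0 < adaptiveRate N₁ τ₁ g₁ t :=
  (Real.sqrt_pos.2 h.pos_left).trans_le (sqrt_le_adaptiveRate ..)

/-- The learning rate of a player is controlled by the movement of the opponent. -/
theorem IsPlay.exists_rate_sq_le (h : IsPlay A N₁ N₂ τ₁ τ₂ g₁ x g₂ y) :
    ∃ K, 0 ≤ K ∧ ∀ t, 1 ≤ t → adaptiveRate N₁ τ₁ g₁ t ^ 2 ≤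
      K + K * ∑ s ∈ Finset.Ico 1 t, movement (adaptiveRate N₂ τ₂ g₂) g₂ y s := by
  obtain ⟨_, _, C₀, hC₀, hdual⟩ := exists_dualNorm_sq_bounds N₁ h.norm_left
  set η := adaptiveRate N₁ τ₁ g₁ with hη
  set m := movement (adaptiveRate N₂ τ₂ g₂) g₂ y with hm
  have hm0 : ∀ t, 0 ≤ m t := movement_nonneg _ _ _
  have hη0 : ∀ t, 0 ≤ η t := fun t => (h.rate_pos t).le
  set K' := C₀ * (2 * ∑ a, ∑ b, A a b ^ 2) with hK'
  have hK'0 : 0 ≤ K' := by positivity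
  -- From round `2` on, the variation of the feedback is Lipschitz in that of the opponent's play.
  have hvar : ∀ t, 1 ≤ t → dualNorm N₁ (g₁ (t + 1) - g₁ t) ^ 2 ≤ K' * (m (t + 1) + m t) := by
    intro t ht
    have h1 : ∀ a, (g₁ (t + 1) a - g₁ t a) ^ 2 ≤ (∑ b, A a b ^ 2) * (2 * (m (t + 1) + m t)) := by
      intro a
      have h2 : g₁ (t + 1) a - g₁ t a = ∑ b, A a b * (y (t + 1) b - y t b) := by
        rw [h.feedback_left t ht, h.feedback_left (t + 1) (by omega), ← Finset.sum_sub_distrib]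
        exact Finset.sum_congr rfl fun b _ => by ring
      rw [h2]
      refine (Finset.sum_mul_sq_le_sq_mul_sq _ _ _).trans ?_
      refine mul_le_mul_of_nonneg_left ?_ (by positivity)
      set X := leader (adaptiveRate N₂ τ₂ g₂) g₂ with hX
      have h3 : ∑ b, (y (t + 1) b - y t b) ^ 2 ≤
          2 * (∑ b, (y (t + 1) b - X (t + 1) b) ^ 2 + ∑ b, (y t b - X (t + 1) b) ^ 2) := by
        rw [← Finset.sum_add_distrib, Finset.mul_sum]
        refine Finset.sum_le_sum fun b _ => ?_
        nlinarith [sq_nonneg ((y (t + 1) b - X (t + 1) b) + (y t b - X (t + 1) b))]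
      have h4 : ∑ b, (y (t + 1) b - X (t + 1) b) ^ 2 ≤ m (t + 1) :=
        le_add_of_nonneg_right (by positivity)
      have h5 : ∑ b, (y t b - X (t + 1) b) ^ 2 ≤ m t := le_add_of_nonneg_left (by positivity)
      linarith
    refine (hdual _).2.2.trans ?_
    rw [hK', mul_assoc]
    refine mul_le_mul_of_nonneg_left ?_ hC₀
    refine (Finset.sum_le_sum fun a _ => h1 a).trans_eq ?_
    rw [← Finset.sum_mul]
    ring
  -- Each `m s` is used in rounds `s` and `s + 1`, and the last one only once so far.
  have hind : ∀ t, 2 ≤ t → η t ^ 2 ≤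
      η 2 ^ 2 + K' * (2 * ∑ s ∈ Finset.Ico 1 t, m s - m (t - 1)) := by
    intro t ht
    induction t, ht using Nat.le_induction with
    | base => simpa [two_mul] using mul_nonneg hK'0 (hm0 1)
    | succ t ht ih =>
      obtain ⟨k, rfl⟩ : ∃ k, t = k + 1 := ⟨t - 1, by omega⟩
      have h1 := hvar k (by omega)
      have h2 : η (k + 1 + 1) ^ 2 = _ := adaptiveRate_succ_sq N₁ h.pos_left g₁ (by omega)
      rw [Nat.add_sub_cancel] at h2 ih
      rw [Finset.sum_Ico_succ_top (by omega : 1 ≤ k + 1), h2, Nat.add_sub_cancel]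
      linarith
  refine ⟨η 2 ^ 2 + 2 * K', by positivity, fun t ht => ?_⟩
  have hS : 0 ≤ ∑ s ∈ Finset.Ico 1 t, m s := Finset.sum_nonneg fun s _ => hm0 s
  have h2 : η t ^ 2 ≤ η 2 ^ 2 + K' * (2 * ∑ s ∈ Finset.Ico 1 t, m s) := by
    rcases ht.eq_or_lt with rfl | ht
    · have := pow_le_pow_left₀ (hη0 1) (adaptiveRate_mono N₁ τ₁ g₁ one_le_two) 2
      have := mul_nonneg hK'0 (mul_nonneg zero_le_two hS)
      linarith
    · refine (hind t ht).trans ?_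
      have := mul_nonneg hK'0 (hm0 (t - 1))
      linarith
  nlinarith [mul_nonneg (sq_nonneg (η 2)) hS]

variable [Nonempty α]

theorem IsPlay.left_mem (h : IsPlay A N₁ N₂ τ₁ τ₂ g₁ x g₂ y) {t : ℕ} (ht : 1 ≤ t) :
    x t ∈ stdSimplex ℝ α := by
  rw [h.follows_left.eq_gibbs ht]
  exact gibbs_mem _ _

theorem IsPlay.exists_feedback_right_bound (h : IsPlay A N₁ N₂ τ₁ τ₂ g₁ x g₂ y) :
    ∃ B, ∀ t b, |g₂ t b| ≤ B := by
  refine ⟨∑ b, ∑ a, |A a b|, fun t b => ?_⟩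
  rcases Nat.eq_zero_or_pos t with rfl | ht
  · rw [h.follows_right.feedback_zero, Pi.zero_apply, abs_zero]
    positivity
  · rw [h.feedback_right t ht b]
    have hx := h.left_mem ht
    calc |∑ a, x t a * -A a b| ≤ ∑ a, |x t a * -A a b| := Finset.abs_sum_le_sum_abs _ _
      _ ≤ ∑ a, |A a b| := Finset.sum_le_sum fun a _ => by
          rw [abs_mul, abs_neg, abs_of_nonneg (hx.1 a)]
          exact mul_le_of_le_one_left (abs_nonneg _) (mem_stdSimplex_le_one hx a)
      _ ≤ ∑ b, ∑ a, |A a b| := Finset.single_le_sum (f := fun b => ∑ a, |A a b|)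
          (fun b _ => by positivity) (Finset.mem_univ b)

/-- The joint energy of the two players at the pair `(p, q)`. -/
noncomputable def jointEnergy (N₁ : Seminorm ℝ (α → ℝ)) (N₂ : Seminorm ℝ (β → ℝ)) (τ₁ τ₂ : ℝ)
    (g₁ : ℕ → α → ℝ) (g₂ : ℕ → β → ℝ) (t : ℕ) (p : α → ℝ) (q : β → ℝ) : ℝ :=
  energy (adaptiveRate N₁ τ₁ g₁) g₁ t p + energy (adaptiveRate N₂ τ₂ g₂) g₂ t q

variable [Nonempty β]

/-- At a saddle point the regrets of the two players add up to something nonnegative, so that the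
joint energy decreases up to a multiple of the increase of the learning rates. -/
theorem IsPlay.exists_jointEnergy_succ_le (h : IsPlay A N₁ N₂ τ₁ τ₂ g₁ x g₂ y) :
    ∃ C, 0 ≤ C ∧ ∃ c > 0, ∀ p q v, IsSaddle A p q v → ∀ t, 1 ≤ t →
      jointEnergy N₁ N₂ τ₁ τ₂ g₁ g₂ (t + 1) p q
          - C * (adaptiveRate N₁ τ₁ g₁ (t + 1) + adaptiveRate N₂ τ₂ g₂ (t + 1)) ≤
        jointEnergy N₁ N₂ τ₁ τ₂ g₁ g₂ t p q
          - C * (adaptiveRate N₁ τ₁ g₁ t + adaptiveRate N₂ τ₂ g₂ t)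
          - c * (movement (adaptiveRate N₁ τ₁ g₁) g₁ x t
            + movement (adaptiveRate N₂ τ₂ g₂) g₂ y t) := by
  obtain ⟨B₁, hB₁⟩ := h.symm.exists_feedback_right_bound
  obtain ⟨B₂, hB₂⟩ := h.exists_feedback_right_bound
  obtain ⟨C₁, hC₁, c₁, hc₁, h₁⟩ :=
    h.follows_left.exists_energy_succ_le h.norm_left h.pos_left hB₁
  obtain ⟨C₂, hC₂, c₂, hc₂, h₂⟩ :=
    h.follows_right.exists_energy_succ_le h.norm_right h.pos_right hB₂
  refine ⟨C₁ + C₂, by positivity, min c₁ c₂, lt_min hc₁ hc₂, fun p q v hpq t ht => ?_⟩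
  have e₁ := h₁ t ht p
  have e₂ := h₂ t ht q
  have hxm := h.left_mem ht
  have hym := h.symm.left_mem ht
  have hregret : 0 ≤ ∑ a, g₁ t a * (x t a - p a) + ∑ b, g₂ t b * (y t b - q b) := by
    have r₁ : ∑ a, g₁ t a * (x t a - p a) =
        ∑ a, x t a * ∑ b, y t b * A a b - ∑ a, p a * ∑ b, y t b * A a b := by
      rw [← Finset.sum_sub_distrib]
      exact Finset.sum_congr rfl fun a _ => by rw [h.feedback_left t ht]; ring
    have r₂ : ∑ b, g₂ t b * (y t b - q b) =
        ∑ b, y t b * ∑ a, x t a * -A a b - ∑ b, q b * ∑ a, x t a * -A a b := by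
      rw [← Finset.sum_sub_distrib]
      exact Finset.sum_congr rfl fun b _ => by rw [h.feedback_right t ht]; ring
    rw [sum_sum_neg_swap, sum_sum_neg_swap] at r₂
    have v₁ : ∑ a, p a * ∑ b, y t b * A a b ≤ v := by
      have := sum_sum_neg_swap A p (y t)
      have h1 : ∑ b, y t b * -v ≤ ∑ b, y t b * ∑ a, p a * -A a b :=
        Finset.sum_le_sum fun b _ => by
          refine mul_le_mul_of_nonneg_left ?_ (hym.1 b)
          simp only [mul_neg, Finset.sum_neg_distrib]
          exact neg_le_neg (hpq.col_le b)
      rw [← Finset.sum_mul, hym.2] at h1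
      linarith
    have v₂ : v ≤ ∑ a, x t a * ∑ b, q b * A a b := by
      have h1 : ∑ a, x t a * v ≤ ∑ a, x t a * ∑ b, q b * A a b :=
        Finset.sum_le_sum fun a _ => mul_le_mul_of_nonneg_left (hpq.le_row a) (hxm.1 a)
      rwa [← Finset.sum_mul, hxm.2, one_mul] at h1
    linarith
  have m₁ := adaptiveRate_mono N₁ τ₁ g₁ (Nat.le_succ t)
  have m₂ := adaptiveRate_mono N₂ τ₂ g₂ (Nat.le_succ t)
  have k₁ := mul_le_mul_of_nonneg_right (min_le_left c₁ c₂)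
    (movement_nonneg (adaptiveRate N₁ τ₁ g₁) g₁ x t)
  have k₂ := mul_le_mul_of_nonneg_right (min_le_right c₁ c₂)
    (movement_nonneg (adaptiveRate N₂ τ₂ g₂) g₂ y t)
  have l₁ := mul_nonneg hC₂ (sub_nonneg.2 m₁)
  have l₂ := mul_nonneg hC₁ (sub_nonneg.2 m₂)
  simp only [jointEnergy, Nat.succ_eq_add_one] at *
  linarith

theorem IsPlay.exists_neg_le_jointEnergy (h : IsPlay A N₁ N₂ τ₁ τ₂ g₁ x g₂ y) :
    ∃ C, 0 ≤ C ∧ ∀ p ∈ stdSimplex ℝ α, ∀ q ∈ stdSimplex ℝ β, ∀ t,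
      -(C * (adaptiveRate N₁ τ₁ g₁ t + adaptiveRate N₂ τ₂ g₂ t)) ≤
        jointEnergy N₁ N₂ τ₁ τ₂ g₁ g₂ t p q := by
  refine ⟨Real.log (Fintype.card α) + Real.log (Fintype.card β),
    add_nonneg (Real.log_natCast_nonneg _) (Real.log_natCast_nonneg _), fun p hp q hq t => ?_⟩
  have h₁ := neg_le_energy g₁ (h.rate_pos t) hp
  have h₂ := neg_le_energy g₂ (h.symm.rate_pos t) hq
  have k₁ := mul_nonneg (Real.log_natCast_nonneg (Fintype.card α)) (h.symm.rate_pos t).le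
  have k₂ := mul_nonneg (Real.log_natCast_nonneg (Fintype.card β)) (h.rate_pos t).le
  rw [jointEnergy]
  linarith

/-- The learning rates stay bounded, and the total movement is finite: the energy bounds the
movement by a multiple of the learning rates, while the square of the learning rates is bounded by
the movement. -/
theorem IsPlay.exists_rate_le_and_sum_movement_le (h : IsPlay A N₁ N₂ τ₁ τ₂ g₁ x g₂ y) :
    ∃ H, ∀ t, 1 ≤ t →
      adaptiveRate N₁ τ₁ g₁ t + adaptiveRate N₂ τ₂ g₂ t ≤ H ∧
      ∑ s ∈ Finset.Ico 1 t, (movement (adaptiveRate N₁ τ₁ g₁) g₁ x s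
        + movement (adaptiveRate N₂ τ₂ g₂) g₂ y s) ≤ H := by
  obtain ⟨p, q, v, hpq, -, -⟩ := exists_strict_saddle A
  obtain ⟨C, hC, c, hc, hstep⟩ := h.exists_jointEnergy_succ_le
  obtain ⟨C', hC', hlow⟩ := h.exists_neg_le_jointEnergy
  obtain ⟨K₁, hK₁, hrate₁⟩ := h.exists_rate_sq_le
  obtain ⟨K₂, hK₂, hrate₂⟩ := h.symm.exists_rate_sq_le
  set η₁ := adaptiveRate N₁ τ₁ g₁
  set η₂ := adaptiveRate N₂ τ₂ g₂
  set m₁ := movement η₁ g₁ x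
  set m₂ := movement η₂ g₂ y
  have hm₁ : ∀ t, 0 ≤ m₁ t := movement_nonneg _ _ _
  have hm₂ : ∀ t, 0 ≤ m₂ t := movement_nonneg _ _ _
  have hη₁ : ∀ t, 0 < η₁ t := h.rate_pos
  have hη₂ : ∀ t, 0 < η₂ t := h.symm.rate_pos
  have hup : ∀ t, 1 ≤ t → jointEnergy N₁ N₂ τ₁ τ₂ g₁ g₂ t p q
      + c * ∑ s ∈ Finset.Ico 1 t, (m₁ s + m₂ s) ≤ C * (η₁ t + η₂ t) := by
    intro t ht
    induction t, ht using Nat.le_induction with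
    | base =>
      have := mul_nonneg hC (add_nonneg (hη₁ 1).le (hη₂ 1).le)
      simpa [jointEnergy, energy_one] using this
    | succ t ht ih =>
      have := hstep p q v hpq t ht
      rw [Finset.sum_Ico_succ_top ht]
      linarith
  set a := 2 * (K₁ + K₂)
  set b := 2 * (K₁ + K₂) * ((C + C') / c)
  have ha : 0 ≤ a := by positivity
  have hb : 0 ≤ b := by positivity
  have hS : ∀ t, 1 ≤ t → ∑ s ∈ Finset.Ico 1 t, (m₁ s + m₂ s) ≤ (C + C') / c * (η₁ t + η₂ t) := by
    intro t ht
    rw [div_mul_eq_mul_div, le_div_iff₀ hc]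
    linarith [hup t ht, hlow p hpq.left_mem q hpq.right_mem t]
  have hη : ∀ t, 1 ≤ t → η₁ t + η₂ t ≤ a + b + 1 := by
    intro t ht
    have h1 := hrate₁ t ht
    have h2 := hrate₂ t ht
    have s₁ : 0 ≤ ∑ s ∈ Finset.Ico 1 t, m₁ s := Finset.sum_nonneg fun s _ => hm₁ s
    have s₂ : 0 ≤ ∑ s ∈ Finset.Ico 1 t, m₂ s := Finset.sum_nonneg fun s _ => hm₂ s
    have h3 := hS t ht
    rw [Finset.sum_add_distrib] at h3
    have h4 := mul_le_mul_of_nonneg_left h3 (by positivity : 0 ≤ 2 * (K₁ + K₂))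
    have h5 : (η₁ t + η₂ t) ^ 2 ≤ a + b * (η₁ t + η₂ t) := by
      have h6 : (η₁ t + η₂ t) ^ 2 ≤ 2 * (η₁ t ^ 2 + η₂ t ^ 2) := by
        nlinarith [sq_nonneg (η₁ t - η₂ t)]
      have h7 := mul_nonneg hK₁ s₁
      have h8 := mul_nonneg hK₂ s₂
      simp only [a, b]
      linarith
    by_contra! hlt
    nlinarith
  refine ⟨max (a + b + 1) ((C + C') / c * (a + b + 1)), fun t ht =>
    ⟨(hη t ht).trans (le_max_left _ _), ((hS t ht).trans ?_).trans (le_max_right _ _)⟩⟩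
  exact mul_le_mul_of_nonneg_left (hη t ht) (by positivity)

/-! ### Limits of the learning rates, the movement and the energy -/

theorem IsPlay.exists_tendsto_rate (h : IsPlay A N₁ N₂ τ₁ τ₂ g₁ x g₂ y) :
    ∃ r > 0, Tendsto (adaptiveRate N₁ τ₁ g₁) atTop (𝓝 r) := by
  obtain ⟨H, hH⟩ := h.exists_rate_le_and_sum_movement_le
  have hbdd : BddAbove (Set.range (adaptiveRate N₁ τ₁ g₁)) := by
    refine ⟨H, ?_⟩
    rintro _ ⟨t, rfl⟩
    have h1 := (hH (t + 1) (by omega)).1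
    have h2 := adaptiveRate_mono N₁ τ₁ g₁ (Nat.le_succ t)
    have h3 := h.symm.rate_pos (t + 1)
    exact h2.trans (by linarith)
  exact ⟨_, (h.rate_pos 0).trans_le (le_ciSup hbdd 0),
    tendsto_atTop_ciSup (adaptiveRate_mono N₁ τ₁ g₁) hbdd⟩

theorem IsPlay.tendsto_movement (h : IsPlay A N₁ N₂ τ₁ τ₂ g₁ x g₂ y) :
    Tendsto (movement (adaptiveRate N₁ τ₁ g₁) g₁ x) atTop (𝓝 0) := by
  obtain ⟨H, hH⟩ := h.exists_rate_le_and_sum_movement_le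
  have hsum : Summable fun t => movement (adaptiveRate N₁ τ₁ g₁) g₁ x (t + 1) := by
    refine summable_of_sum_range_le (c := H) (fun t => movement_nonneg _ _ _ _) fun n => ?_
    refine le_trans ?_ (hH (n + 1) (by omega)).2
    rw [Finset.sum_Ico_eq_sum_range, Nat.add_sub_cancel]
    refine Finset.sum_le_sum fun t _ => ?_
    rw [add_comm 1 t]
    exact le_add_of_nonneg_right (movement_nonneg _ _ _ _)
  exact (tendsto_add_atTop_iff_nat 1).1 hsum.tendsto_atTop_zero

/-- The play is asymptotically the same as the leaders of this round and of the next. -/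
theorem IsPlay.tendsto_sub_leader (h : IsPlay A N₁ N₂ τ₁ τ₂ g₁ x g₂ y) :
    Tendsto (fun t => x t - leader (adaptiveRate N₁ τ₁ g₁) g₁ t) atTop (𝓝 0) ∧
      Tendsto (fun t => x t - leader (adaptiveRate N₁ τ₁ g₁) g₁ (t + 1)) atTop (𝓝 0) := by
  refine ⟨tendsto_zero_of_sum_sq_le (fun t => ?_) h.tendsto_movement,
    tendsto_zero_of_sum_sq_le (fun t => ?_) h.tendsto_movement⟩
  · exact le_add_of_nonneg_right (by positivity)
  · exact le_add_of_nonneg_left (by positivity)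

theorem IsPlay.exists_tendsto_jointEnergy (h : IsPlay A N₁ N₂ τ₁ τ₂ g₁ x g₂ y) {p : α → ℝ}
    {q : β → ℝ} {v : ℝ} (hpq : IsSaddle A p q v) :
    ∃ l, Tendsto (fun t => jointEnergy N₁ N₂ τ₁ τ₂ g₁ g₂ t p q) atTop (𝓝 l) := by
  obtain ⟨C, hC, c, hc, hstep⟩ := h.exists_jointEnergy_succ_le
  obtain ⟨C', hC', hlow⟩ := h.exists_neg_le_jointEnergy
  obtain ⟨H, hH⟩ := h.exists_rate_le_and_sum_movement_le
  obtain ⟨r₁, -, hr₁⟩ := h.exists_tendsto_rate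
  obtain ⟨r₂, -, hr₂⟩ := h.symm.exists_tendsto_rate
  set f : ℕ → ℝ := fun t => jointEnergy N₁ N₂ τ₁ τ₂ g₁ g₂ t p q
    - C * (adaptiveRate N₁ τ₁ g₁ t + adaptiveRate N₂ τ₂ g₂ t) with hf
  have hanti : Antitone fun t => f (t + 1) := by
    refine antitone_nat_of_succ_le fun t => ?_
    have h1 := hstep p q v hpq (t + 1) (by omega)
    have h2 := mul_nonneg hc.le (add_nonneg
      (movement_nonneg (adaptiveRate N₁ τ₁ g₁) g₁ x (t + 1))
      (movement_nonneg (adaptiveRate N₂ τ₂ g₂) g₂ y (t + 1)))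
    simp only [hf]
    linarith
  have hbdd : BddBelow (Set.range fun t => f (t + 1)) := by
    refine ⟨-((C' + C) * H), ?_⟩
    rintro _ ⟨t, rfl⟩
    have h1 := hlow p hpq.left_mem q hpq.right_mem (t + 1)
    have h2 := mul_le_mul_of_nonneg_left (hH (t + 1) (by omega)).1 (add_nonneg hC' hC)
    simp only [hf]
    linarith
  have hlim := (tendsto_add_atTop_iff_nat 1).1 (tendsto_atTop_ciInf hanti hbdd)
  refine ⟨_, (hlim.add ((hr₁.add hr₂).const_mul C)).congr fun t => ?_⟩
  simp only [hf]
  ring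

end TwoPlayers

/-! ### Mixing a saddle point with a cluster point -/

section Support

variable {ι : Type*} [Fintype ι]

theorem exists_pos_of_mem_stdSimplex {p : ι → ℝ} (hp : p ∈ stdSimplex ℝ ι) : ∃ i, 0 < p i := by
  by_contra! hle
  have := Finset.sum_nonpos fun i (_ : i ∈ Finset.univ) => hle i
  rw [hp.2] at this
  linarith

theorem sum_mul_eq_of_const_on_support {p q f : ι → ℝ} {u : ℝ} (hq : q ∈ stdSimplex ℝ ι)
    (hsupp : ∀ i, p i = 0 → q i = 0) (hf : ∀ i, p i ≠ 0 → f i = u) : ∑ i, q i * f i = u := by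
  have h : ∀ i, q i * f i = q i * u := fun i => by
    by_cases hi : p i = 0
    · rw [hsupp i hi, zero_mul, zero_mul]
    · rw [hf i hi]
  rw [Finset.sum_congr rfl fun i _ => h i, ← Finset.sum_mul, hq.2, one_mul]

theorem sum_mul_le_of_min_on_support {p q f : ι → ℝ} (hp : p ∈ stdSimplex ℝ ι)
    (hq : q ∈ stdSimplex ℝ ι) (hf : ∀ i j, 0 < p i → f i ≤ f j) :
    ∑ i, p i * f i ≤ ∑ i, q i * f i := by
  obtain ⟨i₀, hi₀⟩ := exists_pos_of_mem_stdSimplex hp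
  rw [sum_mul_eq_of_const_on_support (u := f i₀) hp (fun _ => id) fun i hi =>
    le_antisymm (hf i i₀ ((hp.1 i).lt_of_ne' hi)) (hf i₀ i hi₀)]
  calc f i₀ = ∑ i, q i * f i₀ := by rw [← Finset.sum_mul, hq.2, one_mul]
    _ ≤ ∑ i, q i * f i :=
      Finset.sum_le_sum fun i _ => mul_le_mul_of_nonneg_left (hf i₀ i hi₀) (hq.1 i)

/-- Small convex combinations do not leave the half-spaces `v ≤ f i` if they start in their
interior wherever they might leave. -/
theorem eventually_forall_le_combo (f g : ι → ℝ) (v : ℝ) (h : ∀ i, v < f i ∨ v ≤ f i ∧ v ≤ g i) :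
    ∀ᶠ ε in 𝓝[>] (0 : ℝ), ∀ i, v ≤ (1 - ε) * f i + ε * g i := by
  rw [eventually_all]
  intro i
  rcases h i with h | ⟨hf, hg⟩
  · have hc : Continuous fun ε : ℝ => (1 - ε) * f i + ε * g i := by fun_prop
    have hlim := hc.tendsto 0
    simp only [sub_zero, one_mul, zero_mul, add_zero] at hlim
    exact nhdsWithin_le_nhds ((hlim.eventually (lt_mem_nhds h)).mono fun _ => le_of_lt)
  · filter_upwards [Ioo_mem_nhdsGT (zero_lt_one' ℝ)] with ε hε
    nlinarith [mul_le_mul_of_nonneg_left hf (sub_nonneg.2 hε.2.le),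
      mul_le_mul_of_nonneg_left hg hε.1.le]

theorem combo_mem {p q : ι → ℝ} (hp : p ∈ stdSimplex ℝ ι) (hq : q ∈ stdSimplex ℝ ι) {ε : ℝ}
    (hε : ε ∈ Set.Ioo (0 : ℝ) 1) : (fun i => (1 - ε) * p i + ε * q i) ∈ stdSimplex ℝ ι :=
  convex_stdSimplex ℝ ι hp hq (sub_nonneg.2 hε.2.le) hε.1.le (sub_add_cancel 1 ε)

end Support

/-- If both payoffs at `(x, y)` are constant on supports that contain those of a strictly
complementary saddle point `(p, q)`, then a move from `(p, q)` towards `(x, y)` stays within the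
set of saddle points for a while. -/
theorem IsSaddle.exists_combo {α β : Type*} [Fintype α] [Fintype β] {A : α → β → ℝ} {p x : α → ℝ}
    {q y : β → ℝ} {v : ℝ} (h : IsSaddle A p q v) (hrow : ∀ a, p a = 0 → v < ∑ b, q b * A a b)
    (hcol : ∀ b, q b = 0 → ∑ a, p a * A a b < v) (hx : x ∈ stdSimplex ℝ α)
    (hy : y ∈ stdSimplex ℝ β) (hpx : ∀ a, x a = 0 → p a = 0) (hqy : ∀ b, y b = 0 → q b = 0)
    (hconst : ∀ a a', 0 < x a → 0 < x a' → ∑ b, y b * A a b = ∑ b, y b * A a' b)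
    (hconst' : ∀ b b', 0 < y b → 0 < y b' → ∑ a, x a * -A a b = ∑ a, x a * -A a b') :
    ∃ ε > 0, IsSaddle A (fun a => (1 - ε) * p a + ε * x a) (fun b => (1 - ε) * q b + ε * y b) v := by
  obtain ⟨a₀, ha₀⟩ := exists_pos_of_mem_stdSimplex hx
  obtain ⟨b₀, hb₀⟩ := exists_pos_of_mem_stdSimplex hy
  set u := ∑ b, y b * A a₀ b with hu_def
  set u' := ∑ a, x a * -A a b₀ with hu'_def
  have hu : ∀ a, x a ≠ 0 → ∑ b, y b * A a b = u := fun a ha =>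
    hconst a a₀ ((hx.1 a).lt_of_ne' ha) ha₀
  have hu' : ∀ b, y b ≠ 0 → ∑ a, x a * -A a b = u' := fun b hb =>
    hconst' b b₀ ((hy.1 b).lt_of_ne' hb) hb₀
  -- The constants are the payoffs at `(x, y)`, `(p, y)` and `(x, q)`.
  have huu' : u' = -u := by
    have h1 := sum_mul_eq_of_const_on_support hx (fun _ => id) hu
    have h2 := sum_mul_eq_of_const_on_support hy (fun _ => id) hu'
    rw [sum_sum_neg_swap, h1] at h2
    exact h2.symm
  have hle : u ≤ v := by
    have h1 := sum_mul_eq_of_const_on_support h.left_mem hpx hu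
    have h2 := sum_sum_neg_swap A p y
    have h3 : ∑ b, y b * -v ≤ ∑ b, y b * ∑ a, p a * -A a b :=
      Finset.sum_le_sum fun b _ => by
        refine mul_le_mul_of_nonneg_left ?_ (hy.1 b)
        simp only [mul_neg, Finset.sum_neg_distrib]
        exact neg_le_neg (h.col_le b)
    rw [← Finset.sum_mul, hy.2] at h3
    linarith
  have hge : v ≤ u := by
    have h1 := sum_mul_eq_of_const_on_support h.right_mem hqy hu'
    rw [sum_sum_neg_swap] at h1
    have h2 : ∑ a, x a * v ≤ ∑ a, x a * ∑ b, q b * A a b :=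
      Finset.sum_le_sum fun a _ => mul_le_mul_of_nonneg_left (h.le_row a) (hx.1 a)
    rw [← Finset.sum_mul, hx.2] at h2
    linarith
  have huv : u = v := le_antisymm hle hge
  have e₁ := eventually_forall_le_combo (fun a => ∑ b, q b * A a b) (fun a => ∑ b, y b * A a b) v
    fun a => by
      by_cases ha : x a = 0
      · exact Or.inl (hrow a (hpx a ha))
      · exact Or.inr ⟨h.le_row a, (huv.symm.trans (hu a ha).symm).le⟩
  have e₂ := eventually_forall_le_combo (fun b => ∑ a, p a * -A a b) (fun b => ∑ a, x a * -A a b)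
    (-v) fun b => by
      by_cases hb : y b = 0
      · refine Or.inl ?_
        simp only [mul_neg, Finset.sum_neg_distrib]
        exact neg_lt_neg (hcol b (hqy b hb))
      · refine Or.inr ⟨?_, ?_⟩
        · simp only [mul_neg, Finset.sum_neg_distrib]
          exact neg_le_neg (h.col_le b)
        · rw [hu' b hb, huu', huv]
  obtain ⟨ε, h₁, h₂, hε⟩ := (e₁.and (e₂.and (Ioo_mem_nhdsGT (zero_lt_one' ℝ)))).exists
  refine ⟨ε, hε.1, combo_mem h.left_mem hx hε, combo_mem h.right_mem hy hε, fun a => ?_, fun b => ?_⟩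
  · refine (h₁ a).trans_eq ?_
    rw [Finset.mul_sum, Finset.mul_sum, ← Finset.sum_add_distrib]
    exact Finset.sum_congr rfl fun b _ => by ring
  · refine neg_le_neg_iff.1 ((h₂ b).trans_eq ?_)
    rw [Finset.mul_sum, Finset.mul_sum, ← Finset.sum_add_distrib, ← Finset.sum_neg_distrib]
    exact Finset.sum_congr rfl fun a _ => by ring

/-! ### Cluster points and the limit of the play -/

theorem tendsto_kl_zero {ι : Type*} [Fintype ι] {p : ι → ℝ} {u : ℕ → ι → ℝ}
    (hu : Tendsto u atTop (𝓝 p)) : Tendsto (fun k => kl p (u k)) atTop (𝓝 0) := by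
  have h : ∀ i, Tendsto (fun k => p i * (Real.log (p i) - Real.log (u k i))) atTop (𝓝 0) := by
    intro i
    rcases eq_or_ne (p i) 0 with hi | hi
    · simp [hi]
    · have h1 := ((tendsto_pi_nhds.1 hu i).log hi).const_sub (Real.log (p i))
      simpa using h1.const_mul (p i)
  simpa [kl] using tendsto_finsetSum Finset.univ fun i _ => h i

section Limit

variable {α β : Type*} [Fintype α] [Fintype β] {A : α → β → ℝ}
  {N₁ : Seminorm ℝ (α → ℝ)} {N₂ : Seminorm ℝ (β → ℝ)} {τ₁ τ₂ : ℝ}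
  {g₁ x : ℕ → α → ℝ} {g₂ y : ℕ → β → ℝ}

theorem tendsto_sum_mul {Y : ℕ → β → ℝ} {ys : β → ℝ} (hY : Tendsto Y atTop (𝓝 ys)) (f : β → ℝ) :
    Tendsto (fun t => ∑ b, Y t b * f b) atTop (𝓝 (∑ b, ys b * f b)) :=
  tendsto_finsetSum _ fun b _ => (tendsto_pi_nhds.1 hY b).mul_const _

variable [Nonempty α]

theorem IsPlay.mul_kl_leader_nonneg (h : IsPlay A N₁ N₂ τ₁ τ₂ g₁ x g₂ y) {p : α → ℝ}
    (hp : p ∈ stdSimplex ℝ α) (t : ℕ) :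
    0 ≤ adaptiveRate N₁ τ₁ g₁ t * kl p (leader (adaptiveRate N₁ τ₁ g₁) g₁ t) :=
  mul_nonneg (h.rate_pos t).le (kl_nonneg hp (leader_mem _ _ _) (leader_pos _ _ _))

/-- The leaders keep away from zero on the support of a mixed strategy to which their relative
entropy stays bounded. -/
theorem IsPlay.pos_of_cluster (h : IsPlay A N₁ N₂ τ₁ τ₂ g₁ x g₂ y) {p : α → ℝ}
    (hp : p ∈ stdSimplex ℝ α) {M : ℝ} (hM : ∀ᶠ t in atTop,
      adaptiveRate N₁ τ₁ g₁ t * kl p (leader (adaptiveRate N₁ τ₁ g₁) g₁ t) ≤ M)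
    {φ : ℕ → ℕ} (hφ : Tendsto φ atTop atTop) {xs : α → ℝ}
    (hX : Tendsto (fun k => leader (adaptiveRate N₁ τ₁ g₁) g₁ (φ k)) atTop (𝓝 xs)) {a : α}
    (ha : xs a = 0) : p a = 0 := by
  by_contra hpa
  have hpa' : 0 < p a := (hp.1 a).lt_of_ne' hpa
  have hτ : 0 < √τ₁ := Real.sqrt_pos.2 h.pos_left
  set X := leader (adaptiveRate N₁ τ₁ g₁) g₁ with hXdef
  have hlow : ∀ᶠ t in atTop,
      Real.exp (-((M / √τ₁ + Real.log (Fintype.card α)) / p a)) ≤ X t a := by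
    filter_upwards [hM] with t ht
    have hmem : X t ∈ stdSimplex ℝ α := leader_mem _ _ _
    have hpos : ∀ i, 0 < X t i := leader_pos _ _ _
    have hk0 := kl_nonneg hp hmem hpos
    have hk : kl p (X t) ≤ M / √τ₁ := by
      rw [le_div_iff₀ hτ]
      have := mul_le_mul_of_nonneg_right (sqrt_le_adaptiveRate N₁ τ₁ g₁ t) hk0
      linarith
    have hrel := relEntropy_nonneg hp
    have hsingle : p a * -Real.log (X t a) ≤ ∑ i, p i * -Real.log (X t i) :=
      Finset.single_le_sum (f := fun i => p i * -Real.log (X t i)) (fun i _ =>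
        mul_nonneg (hp.1 i) (neg_nonneg.2 (Real.log_nonpos (hmem.1 i)
          (mem_stdSimplex_le_one hmem i)))) (Finset.mem_univ a)
    have hsplit : kl p (X t) = ∑ i, p i * Real.log (p i) + ∑ i, p i * -Real.log (X t i) := by
      rw [kl, ← Finset.sum_add_distrib]
      exact Finset.sum_congr rfl fun i _ => by ring
    rw [relEntropy] at hrel
    rw [← Real.le_log_iff_exp_le (hpos a), neg_le, le_div_iff₀ hpa']
    linarith
  have hlim := ge_of_tendsto (tendsto_pi_nhds.1 hX a) (hφ.eventually hlow)
  rw [ha] at hlim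
  exact absurd hlim (not_le.2 (Real.exp_pos _))

theorem IsPlay.tendsto_leader_of_tendsto_kl (h : IsPlay A N₁ N₂ τ₁ τ₂ g₁ x g₂ y) {p : α → ℝ}
    (hp : p ∈ stdSimplex ℝ α) {f : ℕ → ℝ}
    (hf : ∀ t, adaptiveRate N₁ τ₁ g₁ t * kl p (leader (adaptiveRate N₁ τ₁ g₁) g₁ t) ≤ f t)
    (hlim : Tendsto f atTop (𝓝 0)) :
    Tendsto (leader (adaptiveRate N₁ τ₁ g₁) g₁) atTop (𝓝 p) := by
  have hτ : 0 < √τ₁ := Real.sqrt_pos.2 h.pos_left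
  have h1 : Tendsto (fun t => p - leader (adaptiveRate N₁ τ₁ g₁) g₁ t) atTop (𝓝 0) := by
    refine tendsto_zero_of_sum_sq_le (f := fun t => 4 / √τ₁ * f t) (fun t => ?_) ?_
    · have hmem := leader_mem (adaptiveRate N₁ τ₁ g₁) g₁ t
      have hpos := leader_pos (adaptiveRate N₁ τ₁ g₁) g₁ t
      have h1 := sum_sq_sub_le_kl hp hmem hpos
      have h2 := mul_le_mul_of_nonneg_right (sqrt_le_adaptiveRate N₁ τ₁ g₁ t)
        (kl_nonneg hp hmem hpos)
      rw [div_mul_eq_mul_div, le_div_iff₀ hτ]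
      have h3 := mul_le_mul_of_nonneg_left h1 hτ.le
      have h4 := hf t
      simp only [Pi.sub_apply]
      linarith
    · simpa using hlim.const_mul (4 / √τ₁)
  simpa using h1.const_sub p

variable [Nonempty β]

/-- Where the joint energy converges, so does the weighted relative entropy to the leaders. -/
theorem IsPlay.exists_tendsto_kl (h : IsPlay A N₁ N₂ τ₁ τ₂ g₁ x g₂ y) {p : α → ℝ} {q : β → ℝ}
    (hp : p ∈ stdSimplex ℝ α) (hq : q ∈ stdSimplex ℝ β) {l : ℝ}
    (hl : Tendsto (fun t => jointEnergy N₁ N₂ τ₁ τ₂ g₁ g₂ t p q) atTop (𝓝 l)) :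
    ∃ l', Tendsto (fun t =>
      adaptiveRate N₁ τ₁ g₁ t * kl p (leader (adaptiveRate N₁ τ₁ g₁) g₁ t)
        + adaptiveRate N₂ τ₂ g₂ t * kl q (leader (adaptiveRate N₂ τ₂ g₂) g₂ t))
      atTop (𝓝 l') := by
  obtain ⟨r₁, -, hr₁⟩ := h.exists_tendsto_rate
  obtain ⟨r₂, -, hr₂⟩ := h.symm.exists_tendsto_rate
  refine ⟨_, (hl.add ((hr₁.mul_const (relEntropy p)).add (hr₂.mul_const (relEntropy q)))).congr
    fun t => ?_⟩
  rw [← energy_add_relEntropy g₁ (h.rate_pos t) hp,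
    ← energy_add_relEntropy g₂ (h.symm.rate_pos t) hq, jointEnergy]
  ring

/-- At a cluster point the pure strategies in the support have the same loss, since otherwise their
probabilities would still be changing there. -/
theorem IsPlay.feedback_eq_of_cluster (h : IsPlay A N₁ N₂ τ₁ τ₂ g₁ x g₂ y)
    {φ : ℕ → ℕ} (hφ : Tendsto φ atTop atTop) {xs : α → ℝ} {ys : β → ℝ}
    (hX : Tendsto (fun k => leader (adaptiveRate N₁ τ₁ g₁) g₁ (φ k)) atTop (𝓝 xs))
    (hY : Tendsto (fun k => leader (adaptiveRate N₂ τ₂ g₂) g₂ (φ k)) atTop (𝓝 ys)) (a a' : α)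
    (ha : 0 < xs a) (ha' : 0 < xs a') : ∑ b, ys b * A a b = ∑ b, ys b * A a' b := by
  obtain ⟨r, -, hr⟩ := h.exists_tendsto_rate
  set η := adaptiveRate N₁ τ₁ g₁ with hη
  have hy : Tendsto (fun k => y (φ k)) atTop (𝓝 ys) := by
    simpa using (h.symm.tendsto_sub_leader.1.comp hφ).add hY
  have hX' : Tendsto (fun k => leader η g₁ (φ k + 1)) atTop (𝓝 xs) := by
    have h1 := (h.tendsto_sub_leader.1.comp hφ).add hX
    have h2 := h1.sub (h.tendsto_sub_leader.2.comp hφ)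
    rw [zero_add, sub_zero] at h2
    refine h2.congr fun k => ?_
    simp only [Function.comp_apply, ← hη, sub_add_cancel, sub_sub_cancel]
  have hφ1 : Tendsto (fun k => φ k + 1) atTop atTop := (tendsto_add_atTop_nat 1).comp hφ
  have hlog : ∀ ψ : ℕ → ℕ, Tendsto ψ atTop atTop →
      Tendsto (fun k => leader η g₁ (ψ k)) atTop (𝓝 xs) →
      Tendsto (fun k => cumLoss g₁ (ψ k) a' - cumLoss g₁ (ψ k) a) atTop
        (𝓝 (r * (Real.log (xs a) - Real.log (xs a')))) := by
    intro ψ hψ hlim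
    refine ((hr.comp hψ).mul (((tendsto_pi_nhds.1 hlim a).log ha.ne').sub
      ((tendsto_pi_nhds.1 hlim a').log ha'.ne'))).congr fun k => ?_
    exact adaptiveRate_mul_log_leader_sub N₁ h.pos_left g₁ (ψ k) a a'
  have h1 := (hlog _ hφ1 hX').sub (hlog φ hφ hX)
  rw [sub_self] at h1
  have h2 : Tendsto (fun k => ∑ b, y (φ k) b * A a' b - ∑ b, y (φ k) b * A a b) atTop
      (𝓝 (∑ b, ys b * A a' b - ∑ b, ys b * A a b)) :=
    (tendsto_sum_mul hy _).sub (tendsto_sum_mul hy _)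
  have h3 : ∀ᶠ k in atTop, (cumLoss g₁ (φ k + 1) a' - cumLoss g₁ (φ k + 1) a
      - (cumLoss g₁ (φ k) a' - cumLoss g₁ (φ k) a)) =
      ∑ b, y (φ k) b * A a' b - ∑ b, y (φ k) b * A a b := by
    filter_upwards [hφ.eventually (eventually_ge_atTop 1)] with k hk
    rw [cumLoss_succ g₁ hk, Pi.add_apply, Pi.add_apply, h.feedback_left _ hk, h.feedback_left _ hk]
    ring
  have h4 := tendsto_nhds_unique (h1.congr' h3) h2
  linarith

/-- If the play converges, then no pure strategy has a smaller loss in the limit than those in the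
support, since otherwise its probability would grow exponentially relative to theirs. -/
theorem IsPlay.feedback_le_of_tendsto (h : IsPlay A N₁ N₂ τ₁ τ₂ g₁ x g₂ y) {xs : α → ℝ}
    {ys : β → ℝ} (hX : Tendsto (leader (adaptiveRate N₁ τ₁ g₁) g₁) atTop (𝓝 xs))
    (hy : Tendsto y atTop (𝓝 ys)) (a a' : α) (ha : 0 < xs a) :
    ∑ b, ys b * A a b ≤ ∑ b, ys b * A a' b := by
  by_contra! hlt
  obtain ⟨r, hr0, hr⟩ := h.exists_tendsto_rate
  set η := adaptiveRate N₁ τ₁ g₁ with hη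
  set f : ℕ → ℝ := fun t => cumLoss g₁ t a - cumLoss g₁ t a' with hf
  obtain ⟨M, hM⟩ : ∃ M, ∀ᶠ t in atTop, f t ≤ M := by
    have h1 := hr.mul (((tendsto_pi_nhds.1 hX a).log ha.ne').neg)
    refine ⟨r * -Real.log (xs a) + 1,
      (h1.eventually (gt_mem_nhds (lt_add_one _))).mono fun t ht => ?_⟩
    have h2 := adaptiveRate_mul_log_leader_sub N₁ h.pos_left g₁ t a' a
    have h3 : η t * Real.log (leader η g₁ t a') ≤ 0 :=
      mul_nonpos_of_nonneg_of_nonpos (h.rate_pos t).le (Real.log_nonpos (leader_pos _ _ _ _).le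
        (mem_stdSimplex_le_one (leader_mem _ _ _) a'))
    have h4 : f t = _ := h2.symm
    rw [← hη] at h4
    rw [h4]
    linarith
  obtain ⟨δ, hδ, hδ'⟩ := exists_between (sub_pos.2 hlt)
  have hinc : ∀ᶠ t in atTop, f t + δ ≤ f (t + 1) := by
    have h1 := (tendsto_sum_mul hy (A a)).sub (tendsto_sum_mul hy (A a'))
    filter_upwards [h1.eventually (lt_mem_nhds hδ'), eventually_ge_atTop 1] with t ht ht1
    simp only [hf]
    rw [cumLoss_succ g₁ ht1, Pi.add_apply, Pi.add_apply, h.feedback_left _ ht1,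
      h.feedback_left _ ht1]
    linarith
  obtain ⟨T, hT⟩ := eventually_atTop.1 (hM.and hinc)
  have hgrow : ∀ k : ℕ, f T + k * δ ≤ f (T + k) := by
    intro k
    induction k with
    | zero => simp
    | succ k ih =>
      have := (hT (T + k) (by omega)).2
      push_cast
      rw [← add_assoc]
      linarith
  obtain ⟨k, hk⟩ := exists_nat_gt ((M - f T) / δ)
  rw [div_lt_iff₀ hδ] at hk
  linarith [hgrow k, (hT (T + k) (by omega)).1]

/-- The leaders of both players converge: the joint energy converges at a strictly complementary
saddle point and at a point slightly off it in the direction of a cluster point, hence at the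
cluster point itself. -/
theorem IsPlay.exists_tendsto_leader (h : IsPlay A N₁ N₂ τ₁ τ₂ g₁ x g₂ y) :
    ∃ xs ∈ stdSimplex ℝ α, ∃ ys ∈ stdSimplex ℝ β,
      Tendsto (leader (adaptiveRate N₁ τ₁ g₁) g₁) atTop (𝓝 xs) ∧
      Tendsto (leader (adaptiveRate N₂ τ₂ g₂) g₂) atTop (𝓝 ys) := by
  obtain ⟨p, q, v, hpq, hrow, hcol⟩ := exists_strict_saddle A
  obtain ⟨l, hl⟩ := h.exists_tendsto_jointEnergy hpq
  obtain ⟨M, hM⟩ := h.exists_tendsto_kl hpq.left_mem hpq.right_mem hl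
  have hM' := hM.eventually (gt_mem_nhds (lt_add_one M))
  obtain ⟨⟨xs, ys⟩, ⟨hxs, hys⟩, φ, hφ, hlim⟩ :=
    ((isCompact_stdSimplex ℝ α).prod (isCompact_stdSimplex ℝ β)).tendsto_subseq
      (x := fun t => (leader (adaptiveRate N₁ τ₁ g₁) g₁ t, leader (adaptiveRate N₂ τ₂ g₂) g₂ t))
      fun t => ⟨leader_mem _ _ _, leader_mem _ _ _⟩
  have hφ' := hφ.tendsto_atTop
  obtain ⟨hX, hY⟩ := (Prod.tendsto_iff _ _).1 hlim
  simp only [Function.comp_def] at hX hY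
  obtain ⟨ε, hε, hsaddle⟩ := hpq.exists_combo hrow hcol hxs hys
    (fun a => h.pos_of_cluster hpq.left_mem (M := M + 1) (hM'.mono fun t ht => by
      linarith [h.symm.mul_kl_leader_nonneg hpq.right_mem t]) hφ' hX)
    (fun b => h.symm.pos_of_cluster hpq.right_mem (M := M + 1) (hM'.mono fun t ht => by
      linarith [h.mul_kl_leader_nonneg hpq.left_mem t]) hφ' hY)
    (h.feedback_eq_of_cluster hφ' hX hY) (h.symm.feedback_eq_of_cluster hφ' hY hX)
  -- The energy is affine, so it converges on the line through two saddle points.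
  obtain ⟨l', hl'⟩ := h.exists_tendsto_jointEnergy hsaddle
  have hE : Tendsto (fun t => jointEnergy N₁ N₂ τ₁ τ₂ g₁ g₂ t xs ys) atTop
      (𝓝 (ε⁻¹ * (l' - (1 - ε) * l))) := by
    refine ((hl'.sub (hl.const_mul (1 - ε))).const_mul ε⁻¹).congr fun t => ?_
    rw [jointEnergy, energy_combo, energy_combo, jointEnergy, jointEnergy]
    field_simp
    ring
  obtain ⟨D, hD⟩ := h.exists_tendsto_kl hxs hys hE
  obtain ⟨r₁, -, hr₁⟩ := h.exists_tendsto_rate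
  obtain ⟨r₂, -, hr₂⟩ := h.symm.exists_tendsto_rate
  have hD0 : D = 0 := by
    refine tendsto_nhds_unique (hD.comp hφ') ?_
    simpa [Function.comp_def] using ((hr₁.comp hφ').mul (tendsto_kl_zero hX)).add
      ((hr₂.comp hφ').mul (tendsto_kl_zero hY))
  rw [hD0] at hD
  exact ⟨xs, hxs, ys, hys,
    h.tendsto_leader_of_tendsto_kl hxs
      (fun t => le_add_of_nonneg_right (h.symm.mul_kl_leader_nonneg hys t)) hD,
    h.symm.tendsto_leader_of_tendsto_kl hys
      (fun t => le_add_of_nonneg_left (h.mul_kl_leader_nonneg hxs t)) hD⟩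

end Limit

/-! ### Expected losses -/

theorem mixedLoss_eq_left {α β : Type*} [Fintype α] [Fintype β] (ℓ : α → β → ℝ) (x : α → ℝ)
    (y : β → ℝ) : mixedLoss ℓ x y = ∑ a, x a * ∑ b, y b * ℓ a b := by
  simp only [mixedLoss, Finset.mul_sum, mul_assoc]

theorem mixedLoss_eq_right {α β : Type*} [Fintype α] [Fintype β] (ℓ : α → β → ℝ) (x : α → ℝ)
    (y : β → ℝ) : mixedLoss ℓ x y = ∑ b, y b * ∑ a, x a * ℓ a b := by
  simp only [mixedLoss, Finset.mul_sum]
  rw [Finset.sum_comm]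
  exact Finset.sum_congr rfl fun b _ => Finset.sum_congr rfl fun a _ => by ring

end AdaptiveOMWU

theorem mainTheorem7 {α β : Type*} [Fintype α] [Nonempty α] [Fintype β] [Nonempty β]
    -- a finite two-player zero-sum game
    (ℓ₁ ℓ₂ : α → β → ℝ) (hzero : ∀ a b, ℓ₁ a b + ℓ₂ a b = 0)
    -- for each player, a norm and a constant that enter the adaptive learning rate
    (N₁ : Seminorm ℝ (α → ℝ)) (hN₁ : ∀ v, N₁ v = 0 → v = 0)
    (N₂ : Seminorm ℝ (β → ℝ)) (hN₂ : ∀ v, N₂ v = 0 → v = 0)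
    (τ₁ τ₂ : ℝ) (hτ₁ : 0 < τ₁) (hτ₂ : 0 < τ₂)
    -- the sequences of play and of feedback
    (x g₁ : ℕ → α → ℝ) (y g₂ : ℕ → β → ℝ)
    (hg₁ : ∀ t, 1 ≤ t → g₁ t = AdaptiveOMWU.feedbackLeft ℓ₁ (y t))
    (hg₂ : ∀ t, 1 ≤ t → g₂ t = AdaptiveOMWU.feedbackRight ℓ₂ (x t))
    (hx : AdaptiveOMWU.FollowsAdaptiveOMWU N₁ τ₁ g₁ x)
    (hy : AdaptiveOMWU.FollowsAdaptiveOMWU N₂ τ₂ g₂ y) :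
    ∃ (xs : α → ℝ) (ys : β → ℝ), AdaptiveOMWU.IsNash ℓ₁ ℓ₂ xs ys ∧
      Tendsto x atTop (𝓝 xs) ∧ Tendsto y atTop (𝓝 ys) := by
  obtain rfl : ℓ₂ = fun a b => -ℓ₁ a b := by
    ext a b
    linarith [hzero a b]
  have h : AdaptiveOMWU.IsPlay ℓ₁ N₁ N₂ τ₁ τ₂ g₁ x g₂ y :=
    ⟨hN₁, hN₂, hτ₁, hτ₂, fun t ht a => by rw [hg₁ t ht, AdaptiveOMWU.feedbackLeft],
      fun t ht b => by rw [hg₂ t ht, AdaptiveOMWU.feedbackRight], hx, hy⟩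
  obtain ⟨xs, hxs, ys, hys, hX, hY⟩ := h.exists_tendsto_leader
  have hxlim : Tendsto x atTop (𝓝 xs) := by simpa using h.tendsto_sub_leader.1.add hX
  have hylim : Tendsto y atTop (𝓝 ys) := by simpa using h.symm.tendsto_sub_leader.1.add hY
  refine ⟨xs, ys, ⟨hxs, hys, fun x' hx' => ?_, fun y' hy' => ?_⟩, hxlim, hylim⟩
  · rw [AdaptiveOMWU.mixedLoss_eq_left, AdaptiveOMWU.mixedLoss_eq_left]
    exact AdaptiveOMWU.sum_mul_le_of_min_on_support hxs hx'
      (h.feedback_le_of_tendsto hX hylim)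
  · rw [AdaptiveOMWU.mixedLoss_eq_right, AdaptiveOMWU.mixedLoss_eq_right]
    exact AdaptiveOMWU.sum_mul_le_of_min_on_support hys hy'
      (h.symm.feedback_le_of_tendsto hY hxlim)
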